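/- Let $k$ be a commutative ring, $A$ an associative unital $k$-algebra and $C$ a coassociative counital $k$-coalgebra; write $\otimes=\otimes_k$ and $\Delta(c)=c_{(1)}\otimes c_{(2)}$. Let $(A,C,\psi)$ be a (right-right) entwining structure, i.e. $\psi:C\otimes A\to A\otimes C$, $\psi(c\otimes a)=a_\psi\otimes c^\psi=a_\Psi\otimes c^\Psi$, is a $k$-linear map with $$(ab)_\psi\otimes c^\psi=a_\psi b_\Psi\otimes c^{\psi\Psi},\quad 1_\psi\otimes c^\psi=1\otimes c,\quad a_\psi\otimes\Delta(c^\psi)=a_{\psi\Psi}\otimes c_{(1)}^{\Psi}\otimes c_{(2)}^{\psi},\quad \varepsilon(c^\psi)a_\psi=\varepsilon(c)a .$$ Let $x\in C$ be a grouplike element ($\Delta(x)=x\otimes x$, $\varepsilon(x)=1$). An entwined module is a right $A$-module $M$ (with the induced $k$-module structure) with a right $C$-comodule structure $\rho(m)=m_{[0]}\otimes m_{[1]}\in M\otimes C$ such that $\rho(ma)=m_{[0]}a_\psi\otimes m_{[1]}^\psi$ (equivalently, a right comodule over the $A$-coring $A\otimes C$); put $M^{\mathrm{co}C}=\{m\in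 M: \rho(m)=m\otimes x\}$. In particular $A$ is an entwined module with $\rho(a)=a_\psi\otimes x^\psi$. Let $B'=A^{\mathrm{co}C}=\{b\in A: b_\psi\otimes x^\psi=b\otimes x\}$, a subalgebra of $A$. For a right $B'$-module $N$, $N\otimes_{B'}A$ is an entwined module with $(n\otimes a')a=n\otimes a'a$ and $\rho(n\otimes a)=(n\otimes a_\psi)\otimes x^\psi$. We say that $(A,C,\psi,x)$ - is *cleft* if there is a $k$-linear map $\lambda:C\to A$, invertible for the convolution product $(f*g)(c)=f(c_{(1)})g(c_{(2)})$, that lies in $Q'=\{q\in\mathrm{Hom}_k(C,A): q(c_{(2)})_\psi\otimes c_{(1)}^\psi=q(c)\otimes x \text{ for all } c\in C\}$; - satisfies the *Strong Structure Theorem* if for every entwined module $M$ the map $\varepsilon_M:M^{\mathrm{co}C}\otimes_{B'}A\to M$, $m\otimes a\mapsto ma$, is bijective, and for every right $B'$-module $N$ the map $\eta_N:N\to(N\otimes_{B'}A)^{\mathrm{co}C}$, $n\mapsto n\otimes1$, is bijective; - satisfies the *right normal basis property* if there is a left $B'$-linear and right $C$-colinear isomorphism $B'\otimes C\cong A$,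 where $C$ coacts on $B'\otimes C$ by $\mathrm{id}\otimes\Delta$; - is *Galois* if $\mathrm{can}:A\otimes_{B'}A\to A\otimes C$, $\mathrm{can}(a\otimes b)=ab_\psi\otimes x^\psi$, is bijective. **Theorem.** The following assertions are equivalent: 1. $(A,C,\psi,x)$ is cleft; 2. $(A,C,\psi,x)$ satisfies the Strong Structure Theorem and the right normal basis property; 3. $(A,C,\psi,x)$ is Galois and satisfies the right normal basis property; 4. the map ${}^*\mathrm{can}:\#(C,A)=\mathrm{Hom}_k(C,A)\to{}_{B'}\mathrm{End}(A)^{\mathrm{op}}$, ${}^*\mathrm{can}(f)(a)=a_\psi f(x^\psi)$, is bijective and $(A,C,\psi,x)$ satisfies the right normal basis property. -/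

import Mathlib

open scoped TensorProduct

universe uk uA uC w

noncomputable section

/-! ### Tensor products over a noncommutative `k`-algebra -/

section BalTensor

variable (k : Type*) {B : Type*} (N : Type*) (L : Type*) [CommRing k] [Ring B]
  [AddCommGroup N] [Module k N] [Module Bᵐᵒᵖ N] [AddCommGroup L] [Module k L] [Module B L]

/-- The relations `n b ⊗ l = n ⊗ b l`. -/
def balRel : Submodule k (N ⊗[k] L) :=
  Submodule.span k {t | ∃ (n : N) (b : B) (l : L),
    t = (MulOpposite.op b • n) ⊗ₜ[k] l - n ⊗ₜ[k] (b • l)}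

/-- The tensor product `N ⊗_B L` of a right and a left module over a `k`-algebra `B`, as a
quotient of `N ⊗_k L`. Right `B`-modules are modules over `Bᵐᵒᵖ`. -/
abbrev BalTensor : Type _ := (N ⊗[k] L) ⧸ balRel k (B := B) N L

variable {N L}

/-- The pure tensor `n ⊗_B l`. -/
def balTmul (n : N) (l : L) : BalTensor k (B := B) N L :=
  Submodule.Quotient.mk (n ⊗ₜ[k] l)

variable {k}

/-- A `B`-balanced `k`-bilinear map induces a map on `N ⊗_B L`. -/
def balLift {P : Type*} [AddCommGroup P] [Module k P] (f : N →ₗ[k] L →ₗ[k] P)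
    (hf : ∀ (n : N) (b : B) (l : L), f (MulOpposite.op b • n) l = f n (b • l)) :
    BalTensor k (B := B) N L →ₗ[k] P :=
  (balRel k (B := B) N L).liftQ (TensorProduct.lift f) (by
    rw [balRel, Submodule.span_le]
    rintro t ⟨n, b, l, rfl⟩
    simp [hf])

@[simp] lemma balLift_tmul {P : Type*} [AddCommGroup P] [Module k P] (f : N →ₗ[k] L →ₗ[k] P)
    (hf : ∀ (n : N) (b : B) (l : L), f (MulOpposite.op b • n) l = f n (b • l)) (n : N) (l : L) :
    balLift f hf (balTmul k n l) = f n l := by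
  simp [balLift, balTmul]

lemma balTmul_smul (n : N) (b : B) (l : L) :
    balTmul k (B := B) (MulOpposite.op b • n) l = balTmul k (B := B) n (b • l) :=
  (Submodule.Quotient.eq _).2 (Submodule.subset_span ⟨n, b, l, rfl⟩)

lemma BalTensor.ext_hom {P : Type*} [AddCommGroup P] [Module k P]
    {f g : BalTensor k (B := B) N L →ₗ[k] P}
    (h : ∀ n l, f (balTmul k n l) = g (balTmul k n l)) : f = g :=
  Submodule.linearMap_qext _ (TensorProduct.ext' h)

variable (k N L) in
/-- `(n, l) ↦ n ⊗_B l` as a `k`-bilinear map. -/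
def balMk : N →ₗ[k] L →ₗ[k] BalTensor k (B := B) N L :=
  (TensorProduct.mk k N L).compr₂ (Submodule.mkQ _)

@[simp] lemma balMk_apply (n : N) (l : L) : balMk k (B := B) N L n l = balTmul k n l := rfl

end BalTensor

/-! ### Entwining structures -/

section Entwining

/-- A (right-right) entwining structure `(A, C, ψ)` over `k`, with `ψ : C ⊗ A → A ⊗ C`. -/
structure Entwining (k : Type uk) (A : Type uA) (C : Type uC) [CommRing k] [Ring A]
    [Algebra k A] [AddCommGroup C] [Module k C] [Coalgebra k C] where
  ψ : C ⊗[k] A →ₗ[k] A ⊗[k] C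
  /-- `(ab)_ψ ⊗ c^ψ = a_ψ b_Ψ ⊗ c^{ψΨ}` -/
  ψ_mul : ψ ∘ₗ (LinearMap.mul' k A).lTensor C =
    (LinearMap.mul' k A).rTensor C ∘ₗ (TensorProduct.assoc k A A C).symm.toLinearMap ∘ₗ
      ψ.lTensor A ∘ₗ (TensorProduct.assoc k A C A).toLinearMap ∘ₗ
      ψ.rTensor A ∘ₗ (TensorProduct.assoc k C A A).symm.toLinearMap
  /-- `1_ψ ⊗ c^ψ = 1 ⊗ c` -/
  ψ_one : ∀ c : C, ψ (c ⊗ₜ 1) = 1 ⊗ₜ c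
  /-- `a_ψ ⊗ Δ(c^ψ) = a_{ψΨ} ⊗ c₁^Ψ ⊗ c₂^ψ` -/
  ψ_comul : (Coalgebra.comul (R := k) (A := C)).lTensor A ∘ₗ ψ =
    (TensorProduct.assoc k A C C).toLinearMap ∘ₗ ψ.rTensor C ∘ₗ
      (TensorProduct.assoc k C A C).symm.toLinearMap ∘ₗ ψ.lTensor C ∘ₗ
      (TensorProduct.assoc k C C A).toLinearMap ∘ₗ
      (Coalgebra.comul (R := k) (A := C)).rTensor A
  /-- `ε(c^ψ) a_ψ = ε(c) a` -/
  ψ_counit : (TensorProduct.rid k A).toLinearMap ∘ₗ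
      (Coalgebra.counit (R := k) (A := C)).lTensor A ∘ₗ ψ =
    (TensorProduct.lid k A).toLinearMap ∘ₗ (Coalgebra.counit (R := k) (A := C)).rTensor A

/-- The right action of `A` on a right `A`-module, `m ⊗ a ↦ m a`. -/
def rightAct (k A M : Type*) [CommRing k] [Ring A] [Algebra k A] [AddCommGroup M] [Module k M]
    [Module Aᵐᵒᵖ M] [IsScalarTower k Aᵐᵒᵖ M] : M →ₗ[k] A →ₗ[k] M :=
  LinearMap.mk₂ k (fun m a => MulOpposite.op a • m)
    (fun m n a => smul_add _ m n)
    (fun r m a => by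
      rw [← algebraMap_smul Aᵐᵒᵖ r m, ← algebraMap_smul Aᵐᵒᵖ r, smul_smul, smul_smul,
        Algebra.commutes])
    (fun m a b => by rw [MulOpposite.op_add, add_smul])
    (fun r m a => by rw [MulOpposite.op_smul, smul_assoc])

@[simp] lemma rightAct_apply {k A M : Type*} [CommRing k] [Ring A] [Algebra k A]
    [AddCommGroup M] [Module k M] [Module Aᵐᵒᵖ M] [IsScalarTower k Aᵐᵒᵖ M] (m : M) (a : A) :
    rightAct k A M m a = MulOpposite.op a • m := rfl

namespace Entwining

variable {k : Type uk} {A : Type uA} {C : Type uC} [CommRing k] [Ring A] [Algebra k A]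
  [AddCommGroup C] [Module k C] [Coalgebra k C]

/-- For a right `A`-module `M`, the right action of `A` on `M ⊗ C`:
`(m ⊗ c) ⊗ a ↦ m a_ψ ⊗ c^ψ`. -/
def twistAct (E : Entwining k A C) (M : Type*) [AddCommGroup M] [Module k M] [Module Aᵐᵒᵖ M]
    [IsScalarTower k Aᵐᵒᵖ M] : (M ⊗[k] C) ⊗[k] A →ₗ[k] M ⊗[k] C :=
  (TensorProduct.lift (rightAct k A M)).rTensor C ∘ₗ
    (TensorProduct.assoc k M A C).symm.toLinearMap ∘ₗ
    E.ψ.lTensor M ∘ₗ (TensorProduct.assoc k M C A).toLinearMap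

/-- The structure of an entwined module on a right `A`-module `M`: a right `C`-coaction `ρ` with
`ρ(m a) = m₀ a_ψ ⊗ m₁^ψ`. -/
structure EntwinedModule (E : Entwining k A C) (M : Type*) [AddCommGroup M] [Module k M]
    [Module Aᵐᵒᵖ M] [IsScalarTower k Aᵐᵒᵖ M] where
  coact : M →ₗ[k] M ⊗[k] C
  coassoc : (TensorProduct.assoc k M C C).toLinearMap ∘ₗ coact.rTensor C ∘ₗ coact =
    (Coalgebra.comul (R := k) (A := C)).lTensor M ∘ₗ coact
  counit : (TensorProduct.rid k M).toLinearMap ∘ₗ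
    (Coalgebra.counit (R := k) (A := C)).lTensor M ∘ₗ coact = LinearMap.id
  coact_act : ∀ (m : M) (a : A),
    coact (MulOpposite.op a • m) = E.twistAct M (coact m ⊗ₜ a)

/-- The right `C`-coaction on `A` given by `x`: `ρ(a) = a_ψ ⊗ x^ψ`. -/
def coactA (E : Entwining k A C) (x : C) : A →ₗ[k] A ⊗[k] C :=
  E.ψ ∘ₗ TensorProduct.mk k C A x

@[simp] lemma coactA_apply (E : Entwining k A C) (x : C) (a : A) :
    E.coactA x a = E.ψ (x ⊗ₜ a) := rfl

lemma ψ_mul_apply (E : Entwining k A C) (c : C) (a b : A) :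
    E.ψ (c ⊗ₜ (a * b)) = E.twistAct A (E.ψ (c ⊗ₜ a) ⊗ₜ b) := by
  have h := LinearMap.congr_fun E.ψ_mul (c ⊗ₜ (a ⊗ₜ b))
  have e : TensorProduct.lift (rightAct k A A) = LinearMap.mul' k A := by
    ext; simp
  simpa [twistAct, e] using h

lemma twistAct_smul (E : Entwining k A C) (b : A) (t : A ⊗[k] C) (a : A) :
    E.twistAct A ((LinearMap.mulLeft k b).rTensor C t ⊗ₜ a) =
      (LinearMap.mulLeft k b).rTensor C (E.twistAct A (t ⊗ₜ a)) := by
  induction t using TensorProduct.induction_on with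
  | zero => simp
  | add t₁ t₂ h₁ h₂ => simp only [map_add, TensorProduct.add_tmul, h₁, h₂]
  | tmul a' c =>
    simp only [twistAct, LinearMap.rTensor_tmul, LinearMap.coe_comp, Function.comp_apply,
      LinearEquiv.coe_coe, TensorProduct.assoc_tmul, LinearMap.lTensor_tmul]
    induction E.ψ (c ⊗ₜ a) using TensorProduct.induction_on with
    | zero => simp
    | add t₁ t₂ h₁ h₂ => simp only [map_add, TensorProduct.tmul_add, h₁, h₂]
    | tmul a'' c' => simp [mul_assoc]

lemma twistAct_tmul_self (E : Entwining k A C) (b : A) (c : C) (a : A) :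
    E.twistAct A ((b ⊗ₜ c) ⊗ₜ a) = (LinearMap.mulLeft k b).rTensor C (E.ψ (c ⊗ₜ a)) := by
  have h := E.twistAct_smul b (1 ⊗ₜ c) a
  have e := E.ψ_mul_apply c 1 a
  rw [one_mul, E.ψ_one] at e
  rw [e, ← h]
  simp

/-- The ring of coinvariants `B' = {b ∈ A | b_ψ ⊗ x^ψ = b ⊗ x}`. -/
def coinvRing (E : Entwining k A C) (x : C) : Subalgebra k A where
  carrier := {b | E.coactA x b = b ⊗ₜ x}
  mul_mem' {a b} ha hb := by
    simp only [Set.mem_ofPred_eq, coactA_apply] at *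
    rw [ψ_mul_apply, ha, twistAct_tmul_self, hb]
    simp
  add_mem' {a b} ha hb := by
    simp only [Set.mem_ofPred_eq] at *
    rw [map_add, ha, hb, TensorProduct.add_tmul]
  algebraMap_mem' r := by
    simp only [Set.mem_ofPred_eq, coactA_apply]
    rw [Algebra.algebraMap_eq_smul_one, TensorProduct.tmul_smul, map_smul, E.ψ_one,
      TensorProduct.smul_tmul']

lemma coactA_mul (E : Entwining k A C) (x : C) (b : E.coinvRing x) (a : A) :
    E.coactA x (b * a) = (LinearMap.mulLeft k (b : A)).rTensor C (E.coactA x a) := by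
  have hb : E.ψ (x ⊗ₜ (b : A)) = (b : A) ⊗ₜ x := b.2
  rw [coactA_apply, ψ_mul_apply, hb, twistAct_tmul_self, coactA_apply]

section RightModules

variable (E : Entwining k A C) (x : C) {M : Type*} [AddCommGroup M] [Module k M]
  [Module Aᵐᵒᵖ M] [IsScalarTower k Aᵐᵒᵖ M]

/-- A right `A`-module is a right `B'`-module by restriction of scalars. -/
instance instRightModule : Module (E.coinvRing x)ᵐᵒᵖ M :=
  Module.compHom M (RingHom.op (E.coinvRing x).val.toRingHom)

instance instRightTower : IsScalarTower k (E.coinvRing x)ᵐᵒᵖ M where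
  smul_assoc r b m := by
    change MulOpposite.op (r • ((MulOpposite.unop b : E.coinvRing x) : A)) • m =
      r • MulOpposite.op ((MulOpposite.unop b : E.coinvRing x) : A) • m
    rw [MulOpposite.op_smul, smul_assoc]

lemma twistAct_coinv (b : E.coinvRing x) (m : M) :
    E.twistAct M ((m ⊗ₜ x) ⊗ₜ (b : A)) = (MulOpposite.op (b : A) • m) ⊗ₜ x := by
  have hb : E.ψ (x ⊗ₜ (b : A)) = (b : A) ⊗ₜ x := b.2
  simp [twistAct, hb]

/-- The coinvariants `M^{co C} = {m | ρ(m) = m ⊗ x}` of an entwined module, a right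
`B'`-submodule of `M`. -/
def coinvariants (D : E.EntwinedModule M) : Submodule (E.coinvRing x)ᵐᵒᵖ M where
  carrier := {m | D.coact m = m ⊗ₜ x}
  add_mem' {m n} hm hn := by
    simp only [Set.mem_ofPred_eq] at *
    rw [map_add, hm, hn, TensorProduct.add_tmul]
  zero_mem' := by simp
  smul_mem' b m hm := by
    simp only [Set.mem_ofPred_eq] at *
    change D.coact (MulOpposite.op ((MulOpposite.unop b : E.coinvRing x) : A) • m) = _
    rw [D.coact_act, hm, twistAct_coinv]
    rfl

/-- The counit `ε_M : M^{co C} ⊗_{B'} A → M`, `m ⊗ a ↦ m a`. -/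
def counitMap (D : E.EntwinedModule M) :
    BalTensor k (B := E.coinvRing x) (E.coinvariants x D) A →ₗ[k] M :=
  balLift ((rightAct k A M).comp ((E.coinvariants x D).subtype.restrictScalars k))
    (fun m b a => by
      change MulOpposite.op a • MulOpposite.op (b : A) • (m : M) =
        MulOpposite.op ((b : A) * a) • (m : M)
      rw [smul_smul, MulOpposite.op_mul])

end RightModules

section Induced

variable (E : Entwining k A C) (x : C) (N : Type*) [AddCommGroup N] [Module k N]
  [Module (E.coinvRing x)ᵐᵒᵖ N]

/-- `N ⊗_{B'} A` for a right `B'`-module `N`. -/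
def Ind : Type _ := BalTensor k (B := E.coinvRing x) N A

instance : AddCommGroup (E.Ind x N) :=
  inferInstanceAs (AddCommGroup (BalTensor k (B := E.coinvRing x) N A))

instance : Module k (E.Ind x N) :=
  inferInstanceAs (Module k (BalTensor k (B := E.coinvRing x) N A))

variable {N}

/-- `n ⊗_{B'} a`. -/
def indTmul (n : N) (a : A) : E.Ind x N := balTmul k (B := E.coinvRing x) n a

variable {E x} in
lemma ind_ext {P : Type*} [AddCommGroup P] [Module k P] {f g : E.Ind x N →ₗ[k] P}
    (h : ∀ n a, f (E.indTmul x n a) = g (E.indTmul x n a)) : f = g :=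
  BalTensor.ext_hom h

variable (N) in
/-- Right multiplication `n ⊗ a' ↦ n ⊗ a' a` on `N ⊗_{B'} A`. -/
def indMul (a : A) : E.Ind x N →ₗ[k] E.Ind x N :=
  balLift (B := E.coinvRing x) (N := N) (L := A)
    ((show N →ₗ[k] A →ₗ[k] E.Ind x N from balMk k (B := E.coinvRing x) N A).compl₂
      (LinearMap.mulRight k a))
    (fun n b a' => by
      have h : ((b • a' : A)) * a = b • (a' * a) := mul_assoc _ _ _
      change balTmul k (B := E.coinvRing x) (MulOpposite.op b • n) (a' * a) =
        balTmul k (B := E.coinvRing x) n ((b • a' : A) * a)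
      rw [h, balTmul_smul])

@[simp] lemma indMul_tmul (a : A) (n : N) (a' : A) :
    E.indMul x N a (E.indTmul x n a') = E.indTmul x n (a' * a) := by
  unfold indMul indTmul
  erw [balLift_tmul]
  rfl

lemma indTmul_add (n : N) (a a' : A) :
    E.indTmul x n (a + a') = E.indTmul x n a + E.indTmul x n a' :=
  map_add (balMk k (B := E.coinvRing x) N A n) a a'

lemma indTmul_zero (n : N) : E.indTmul x n (0 : A) = 0 :=
  map_zero (balMk k (B := E.coinvRing x) N A n)

lemma indTmul_ksmul (r : k) (n : N) (a : A) :
    E.indTmul x n (r • a) = r • E.indTmul x n a :=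
  map_smul (balMk k (B := E.coinvRing x) N A n) r a

/-- The right `A`-module structure `(n ⊗ a') a = n ⊗ a' a` on `N ⊗_{B'} A`. -/
instance : Module Aᵐᵒᵖ (E.Ind x N) where
  smul a t := E.indMul x N a.unop t
  one_smul t := LinearMap.congr_fun (f := E.indMul x N 1) (g := LinearMap.id)
    (ind_ext fun n a => by simp) t
  mul_smul a b t := LinearMap.congr_fun (f := E.indMul x N (b.unop * a.unop))
    (g := E.indMul x N a.unop ∘ₗ E.indMul x N b.unop)
    (ind_ext fun n a' => by simp [mul_assoc]) t
  smul_zero a := map_zero (E.indMul x N a.unop)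
  smul_add a := map_add (E.indMul x N a.unop)
  add_smul a b t := LinearMap.congr_fun (f := E.indMul x N (a.unop + b.unop))
    (g := E.indMul x N a.unop + E.indMul x N b.unop)
    (ind_ext fun n a' => by simp [mul_add, indTmul_add]) t
  zero_smul t := LinearMap.congr_fun (f := E.indMul x N 0) (g := 0)
    (ind_ext fun n a' => by simp [indTmul_zero]) t

@[simp] lemma op_smul_indTmul (a : A) (n : N) (a' : A) :
    MulOpposite.op a • E.indTmul x n a' = E.indTmul x n (a' * a) :=
  E.indMul_tmul x a n a'

instance : IsScalarTower k Aᵐᵒᵖ (E.Ind x N) where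
  smul_assoc r a t := LinearMap.congr_fun (f := E.indMul x N (r • a.unop))
    (g := r • E.indMul x N a.unop)
    (ind_ext fun n a' => by simp [indTmul_ksmul]) t

/-- `a ↦ n ⊗_{B'} a`. -/
def indMk (n : N) : A →ₗ[k] E.Ind x N := balMk k (B := E.coinvRing x) N A n

@[simp] lemma indMk_apply (n : N) (a : A) : E.indMk x n a = E.indTmul x n a := rfl

lemma indTmul_smul (n : N) (b : E.coinvRing x) (a : A) :
    E.indTmul x (MulOpposite.op b • n) a = E.indTmul x n ((b : A) * a) :=
  balTmul_smul n b a

variable (N) in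
/-- The right `C`-coaction `n ⊗ a ↦ n ⊗ a_ψ ⊗ x^ψ` on `N ⊗_{B'} A`. -/
def indCoact : E.Ind x N →ₗ[k] E.Ind x N ⊗[k] C :=
  balLift (B := E.coinvRing x) (N := N) (L := A)
    (((LinearMap.rTensorHom C).comp
      (show N →ₗ[k] A →ₗ[k] E.Ind x N from balMk k (B := E.coinvRing x) N A)).compl₂
        (E.coactA x))
    (fun n b a => by
      have h := E.coactA_mul x b a
      change (E.indMk x (MulOpposite.op b • n)).rTensor C (E.coactA x a) =
        (E.indMk x n).rTensor C (E.coactA x ((b : A) * a))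
      rw [h, ← LinearMap.comp_apply (LinearMap.rTensor C _) (LinearMap.rTensor C _),
        ← LinearMap.rTensor_comp]
      congr 2
      ext a
      exact E.indTmul_smul x n b a)

@[simp] lemma indCoact_tmul (n : N) (a : A) :
    E.indCoact x N (E.indTmul x n a) = (E.indMk x n).rTensor C (E.ψ (x ⊗ₜ a)) := by
  unfold indCoact indTmul
  erw [balLift_tmul]

lemma rTensor_coactA (t : A ⊗[k] C) :
    (E.coactA x).rTensor C t =
      E.ψ.rTensor C ((TensorProduct.assoc k C A C).symm (x ⊗ₜ t)) := by
  induction t using TensorProduct.induction_on with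
  | zero => simp
  | add t₁ t₂ h₁ h₂ => simp only [map_add, TensorProduct.tmul_add, h₁, h₂]
  | tmul a c => simp

/-- `A` itself is an entwined module, with coaction `ρ(a) = a_ψ ⊗ x^ψ`. -/
def moduleA {x : C} (hx : IsGroupLikeElem k x) : E.EntwinedModule A where
  coact := E.coactA x
  coassoc := by
    ext a
    have h := LinearMap.congr_fun E.ψ_comul (x ⊗ₜ a)
    simp only [LinearMap.comp_apply, LinearMap.rTensor_tmul, hx.comul_eq_tmul_self,
      LinearEquiv.coe_coe, TensorProduct.assoc_tmul, LinearMap.lTensor_tmul] at h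
    simp only [LinearMap.comp_apply, LinearEquiv.coe_coe, rTensor_coactA]
    exact h.symm
  counit := by
    ext a
    have h := LinearMap.congr_fun E.ψ_counit (x ⊗ₜ a)
    simp only [LinearMap.comp_apply, LinearMap.rTensor_tmul, hx.counit_eq_one,
      LinearEquiv.coe_coe, TensorProduct.lid_tmul, one_smul] at h
    exact h
  coact_act m a := E.ψ_mul_apply x m a

lemma rTensor_indCoact (n : N) (t : A ⊗[k] C) :
    (E.indCoact x N).rTensor C ((E.indMk x n).rTensor C t) =
      ((E.indMk x n).rTensor C).rTensor C ((E.coactA x).rTensor C t) := by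
  rw [← LinearMap.comp_apply, ← LinearMap.rTensor_comp, ← LinearMap.comp_apply,
    ← LinearMap.rTensor_comp]
  congr 2

lemma twistAct_indMk (n : N) (t : A ⊗[k] C) (a : A) :
    E.twistAct (E.Ind x N) ((E.indMk x n).rTensor C t ⊗ₜ a) =
      (E.indMk x n).rTensor C (E.twistAct A (t ⊗ₜ a)) := by
  induction t using TensorProduct.induction_on with
  | zero => simp
  | add t₁ t₂ h₁ h₂ => simp only [map_add, TensorProduct.add_tmul, h₁, h₂]
  | tmul a' c =>
    simp only [twistAct, LinearMap.rTensor_tmul, LinearMap.coe_comp, Function.comp_apply,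
      LinearEquiv.coe_coe, TensorProduct.assoc_tmul, LinearMap.lTensor_tmul]
    induction E.ψ (c ⊗ₜ a) using TensorProduct.induction_on with
    | zero => simp
    | add t₁ t₂ h₁ h₂ => simp only [map_add, TensorProduct.tmul_add, h₁, h₂]
    | tmul a'' c' => simp

variable {x} (N) in
/-- The entwined module `F(N) = N ⊗_{B'} A`. -/
def indModule (hx : IsGroupLikeElem k x) : E.EntwinedModule (E.Ind x N) where
  coact := E.indCoact x N
  coassoc := by
    refine ind_ext fun n a => ?_
    have h := LinearMap.congr_fun (E.moduleA hx).coassoc a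
    simp only [moduleA, LinearMap.comp_apply, LinearEquiv.coe_coe, coactA_apply] at h
    simp only [LinearMap.comp_apply, LinearEquiv.coe_coe, indCoact_tmul, rTensor_indCoact]
    have e₁ : ∀ s : (A ⊗[k] C) ⊗[k] C,
        TensorProduct.assoc k _ C C (((E.indMk x n).rTensor C).rTensor C s) =
          (E.indMk x n).rTensor (C ⊗[k] C) (TensorProduct.assoc k A C C s) := by
      intro s
      refine LinearMap.congr_fun (f := (TensorProduct.assoc k (E.Ind x N) C C).toLinearMap ∘ₗ
        ((E.indMk x n).rTensor C).rTensor C) (g := (E.indMk x n).rTensor (C ⊗[k] C) ∘ₗ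
          (TensorProduct.assoc k A C C).toLinearMap) ?_ s
      ext; simp
    rw [e₁, h, ← LinearMap.comp_apply (LinearMap.rTensor _ _),
      ← LinearMap.comp_apply (LinearMap.lTensor _ _), LinearMap.rTensor_comp_lTensor,
      LinearMap.lTensor_comp_rTensor]
  counit := by
    refine ind_ext fun n a => ?_
    have h := LinearMap.congr_fun (E.moduleA hx).counit a
    simp only [moduleA, LinearMap.comp_apply, LinearEquiv.coe_coe, coactA_apply] at h
    simp only [LinearMap.comp_apply, LinearEquiv.coe_coe, indCoact_tmul]
    have e₁ : ∀ s : A ⊗[k] k, TensorProduct.rid k _ ((E.indMk x n).rTensor k s) =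
        E.indMk x n (TensorProduct.rid k A s) := by
      intro s
      refine LinearMap.congr_fun (f := (TensorProduct.rid k (E.Ind x N)).toLinearMap ∘ₗ
        (E.indMk x n).rTensor k) (g := E.indMk x n ∘ₗ (TensorProduct.rid k A).toLinearMap) ?_ s
      ext; simp
    rw [← LinearMap.comp_apply, LinearMap.lTensor_comp_rTensor, ← LinearMap.rTensor_comp_lTensor,
      LinearMap.comp_apply, e₁, h]
    rfl
  coact_act m a := by
    refine LinearMap.congr_fun (f := E.indCoact x N ∘ₗ E.indMul x N a)
      (g := E.twistAct (E.Ind x N) ∘ₗ (TensorProduct.mk k _ A).flip a ∘ₗ E.indCoact x N) ?_ m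
    refine ind_ext fun n a' => ?_
    simp [twistAct_indMk, ψ_mul_apply]

variable {x} (N) in
/-- The unit `η_N : N → (N ⊗_{B'} A)^{co C}`, `n ↦ n ⊗ 1`. -/
def unitMap (hx : IsGroupLikeElem k x) : N → E.coinvariants x (E.indModule N hx) :=
  fun n => ⟨E.indTmul x n 1, by
    change E.indCoact x N _ = _
    rw [indCoact_tmul, E.ψ_one]
    simp⟩

end Induced

/-! ### The four properties -/

variable (E : Entwining k A C) (x : C)

/-- `Q' = {q : C → A | q(c₂)_ψ ⊗ c₁^ψ = q(c) ⊗ x}`. -/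
def Q' : Submodule k (C →ₗ[k] A) where
  carrier := {q | ∀ c, E.ψ (q.lTensor C (Coalgebra.comul (R := k) c)) = q c ⊗ₜ x}
  add_mem' {p q} hp hq c := by
    rw [LinearMap.lTensor_add, LinearMap.add_apply, map_add, hp c, hq c, LinearMap.add_apply,
      TensorProduct.add_tmul]
  zero_mem' c := by simp
  smul_mem' r q hq c := by
    rw [LinearMap.lTensor_smul, LinearMap.smul_apply, map_smul, hq c, LinearMap.smul_apply,
      TensorProduct.smul_tmul']

/-- `(A, C, ψ, x)` is cleft: some `λ ∈ Q'` is invertible for the convolution product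
`(f * g)(c) = f(c₁) g(c₂)` on `Hom_k(C, A)`. -/
def IsCleft : Prop :=
  ∃ l : C →ₗ[k] A, l ∈ E.Q' x ∧ IsUnit (WithConv.toConv l)

/-- The right normal basis property: there is a left `B'`-linear and right `C`-colinear
isomorphism `B' ⊗ C ≅ A`. -/
def RightNormalBasis : Prop :=
  ∃ h : (E.coinvRing x ⊗[k] C) ≃ₗ[E.coinvRing x] A, ∀ t : E.coinvRing x ⊗[k] C,
    E.coactA x (h t) =
      (h.toLinearMap.restrictScalars k).rTensor C
        ((TensorProduct.assoc k (E.coinvRing x) C C).symm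
          ((Coalgebra.comul (R := k) (A := C)).lTensor (E.coinvRing x) t))

/-- The canonical map `can : A ⊗_{B'} A → A ⊗ C`, `a ⊗ b ↦ a b_ψ ⊗ x^ψ`. -/
def can : BalTensor k (B := E.coinvRing x) A A →ₗ[k] A ⊗[k] C :=
  balLift (((LinearMap.rTensorHom C).comp (LinearMap.mul k A)).compl₂ (E.coactA x))
    (fun a b a' => by
      change (LinearMap.mulLeft k (a * (b : A))).rTensor C (E.coactA x a') =
        (LinearMap.mulLeft k a).rTensor C (E.coactA x ((b : A) * a'))
      rw [coactA_mul, ← LinearMap.comp_apply (LinearMap.rTensor C _) (LinearMap.rTensor C _),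
        ← LinearMap.rTensor_comp, LinearMap.mulLeft_mul])

/-- `(A, C, ψ, x)` is Galois: the canonical map is bijective. -/
def IsGalois : Prop := Function.Bijective (E.can x)

/-- The map `*can`, sending `f : C → A` to the left `B'`-linear endomorphism
`a ↦ a_ψ f(x^ψ)` of `A`. -/
def starCan : (C →ₗ[k] A) → Module.End (E.coinvRing x) A := fun f =>
  { toFun := fun a => LinearMap.mul' k A (f.lTensor A (E.coactA x a))
    map_add' := fun a b => by simp only [map_add]
    map_smul' := fun b a => by
      change LinearMap.mul' k A (f.lTensor A (E.coactA x ((b : A) * a))) =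
        (b : A) * LinearMap.mul' k A (f.lTensor A (E.coactA x a))
      rw [coactA_mul]
      induction E.coactA x a using TensorProduct.induction_on with
      | zero => simp
      | add t₁ t₂ h₁ h₂ => simp only [map_add, mul_add, h₁, h₂]
      | tmul a' c => simp [mul_assoc] }

/-- The Weak Structure Theorem: `ε_M` is bijective for every entwined module `M`. -/
def WeakStructure : Prop :=
  ∀ (M : Type (max uA uC w)) [AddCommGroup M] [Module k M] [Module Aᵐᵒᵖ M]
    [IsScalarTower k Aᵐᵒᵖ M] (D : E.EntwinedModule M), Function.Bijective (E.counitMap x D)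

variable {x} in
/-- The Strong Structure Theorem: moreover `η_N` is bijective for every right `B'`-module `N`. -/
def StrongStructure (hx : IsGroupLikeElem k x) : Prop :=
  WeakStructure.{uk, uA, uC, w} E x ∧
  ∀ (N : Type (max uA uC w)) [AddCommGroup N] [Module k N] [Module (E.coinvRing x)ᵐᵒᵖ N]
    [IsScalarTower k (E.coinvRing x)ᵐᵒᵖ N], Function.Bijective (E.unitMap N hx)

end Entwining

end Entwining

end

/-! The theorem rests on a duality inside the convolution algebra `Hom_k(C, A)`: if `l` and `m` are
convolution inverse to each other, then `l` lies in `Q'` exactly when `m` is right `C`-colinear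
(`isColinear_of_mem_Q'`, `mem_Q'_of_isColinear`). Cleftness is therefore the existence of a
colinear, convolution invertible `m : C → A`.

Given such a pair, every entwined module `M` has a projection `n ↦ n₀ l(n₁)` onto its coinvariants,
and `m` undoes the loss of information, since `n₀ l(n₁) m(n₂) = n₀ (l * m)(n₁) = n`. This writes
down all the required inverses: `a ↦ a₀ l(a₁) ⊗ a₂` for the normal basis map `b ⊗ c ↦ b m(c)`
(`mulMap_bijective`), `n ↦ n₀ l(n₁) ⊗ m(n₂)` for the counit (`counitMap_bijective`), and `n ⊗ a ↦ n
a₀ l(a₁) m(x)` for the unit (`unitMap_bijective`).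

Conversely, a normal basis is a colinear `m` for which `b ⊗ c ↦ b m(c)` is bijective. What is
missing is invertibility, and for this it is enough that `f ↦ m * f` be bijective
(`isCleft_of_isColinear`). The basis identifies the left `B'`-linear endomorphisms of `A` with
`Hom_k(C, A)`, and turns `*can` into `f ↦ m * f`. It also identifies `A ⊗_{B'} A` with `A ⊗ C`, and
turns `can` into the left `A`-linear map `a ⊗ c ↦ a m(c₁) ⊗ c₂`, whose `A`-dual is again `f ↦ m *
f`. So bijectivity of either canonical map yields cleftness.

The Structure Theorem implies the Galois property because `can` is the counit of the entwined module
`A ⊗ C`, whose coinvariants are `A ⊗ x ≅ A` (`WeakStructure.isGalois`). -/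

open Coalgebra WithConv

noncomputable section

/-! ### Functoriality of the balanced tensor product. -/

section BalTensor

variable {k : Type*} {B : Type*} {N : Type*} {N' : Type*} {L : Type*} [CommRing k] [Ring B]
  [AddCommGroup N] [Module k N] [Module Bᵐᵒᵖ N] [AddCommGroup L] [Module k L] [Module B L]
  [AddCommGroup N'] [Module k N'] [Module Bᵐᵒᵖ N']

/-- The map `N ⊗_B L → N' ⊗_B L` induced by a right `B`-linear map `N → N'`. -/
def balMap (e : N →ₗ[k] N') (he : ∀ (b : B) n, e (MulOpposite.op b • n) = MulOpposite.op b • e n) :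
    BalTensor k (B := B) N L →ₗ[k] BalTensor k (B := B) N' L :=
  balLift ((balMk k (B := B) N' L).comp e) (fun n b l => by
    simp only [LinearMap.comp_apply, he, balMk_apply, balTmul_smul])

@[simp] lemma balMap_tmul (e : N →ₗ[k] N')
    (he : ∀ (b : B) n, e (MulOpposite.op b • n) = MulOpposite.op b • e n) (n : N) (l : L) :
    balMap (L := L) e he (balTmul k n l) = balTmul k (e n) l :=
  balLift_tmul _ _ n l

lemma balMap_bijective (e : N →ₗ[k] N')
    (he : ∀ (b : B) n, e (MulOpposite.op b • n) = MulOpposite.op b • e n)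
    (h : Function.Bijective e) : Function.Bijective (balMap (L := L) e he) := by
  let e' := LinearEquiv.ofBijective e h
  have he' : ∀ (b : B) n,
      e'.symm.toLinearMap (MulOpposite.op b • n) = MulOpposite.op b • e'.symm.toLinearMap n :=
    fun b n => h.1 (by
      rw [he]
      change e' (e'.symm _) = MulOpposite.op b • e' (e'.symm _)
      simp)
  refine Function.bijective_iff_has_inverse.2 ⟨balMap e'.symm.toLinearMap he',
    fun t => LinearMap.congr_fun (f := balMap _ he' ∘ₗ balMap e he) (g := LinearMap.id)
      (BalTensor.ext_hom fun n l => ?_) t,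
    fun t => LinearMap.congr_fun (f := balMap e he ∘ₗ balMap _ he') (g := LinearMap.id)
      (BalTensor.ext_hom fun n l => ?_) t⟩
  · simp only [LinearMap.comp_apply, balMap_tmul, LinearMap.id_apply]
    exact congrArg (balTmul k · l) (e'.symm_apply_apply n)
  · simp only [LinearMap.comp_apply, balMap_tmul, LinearMap.id_apply]
    exact congrArg (balTmul k · l) (e'.apply_symm_apply n)

end BalTensor

namespace Entwining

/-! ### Actions of the convolution algebra `Hom_k(C, A)`. -/

section Convolution

variable {k : Type*} {A : Type*} {C : Type*} [CommRing k] [Ring A] [Algebra k A]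
  [AddCommGroup C] [Module k C] [Coalgebra k C]
  {P : Type*} [AddCommGroup P] [Module k P] [Module A P] [IsScalarTower k A P]

/-- The pairing `c ⊗ d ↦ f(c) F(d)` for `f : C → A` and `F : V → P`. -/
def smulMap {V : Type*} [AddCommGroup V] [Module k V] (f : C →ₗ[k] A) (F : V →ₗ[k] P) :
    C ⊗[k] V →ₗ[k] P :=
  TensorProduct.lift ((Algebra.lsmul k k P).toLinearMap.compl₁₂ f F)

omit [Coalgebra k C] in
@[simp] lemma smulMap_tmul {V : Type*} [AddCommGroup V] [Module k V] (f : C →ₗ[k] A)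
    (F : V →ₗ[k] P) (c : C) (v : V) : smulMap f F (c ⊗ₜ v) = f c • F v := rfl

/-- The convolution `c ↦ f(c₁) F(c₂)` of `f : C → A` with a map from `C` to a left `A`-module. -/
def convSMul (f : C →ₗ[k] A) (F : C →ₗ[k] P) : C →ₗ[k] P :=
  smulMap f F ∘ₗ comul

lemma convSMul_apply (f : C →ₗ[k] A) (F : C →ₗ[k] P) (c : C) :
    convSMul f F c = smulMap f F (comul c) := rfl

/-- Both sides are `f(c₁) g(c₂) F(c₃)`, by coassociativity. Together with `one_convSMul` this makes
`Hom_k(C, P)` a left module over the convolution algebra, so that convolution invertible maps can be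
cancelled from identities with values in `P = A ⊗ C`. -/
lemma convSMul_assoc (f g : C →ₗ[k] A) (F : C →ₗ[k] P) :
    convSMul f (convSMul g F) = convSMul (toConv f * toConv g).ofConv F := by
  have h₁ : ∀ t : C ⊗[k] C, smulMap f (convSMul g F) t =
      smulMap f (smulMap g F) (comul.lTensor C t) := fun t => by
    induction t using TensorProduct.induction_on with
    | zero => simp
    | add t₁ t₂ h₁ h₂ => simp only [map_add, h₁, h₂]
    | tmul c d => simp [convSMul_apply]
  have h₃ : ∀ (s : C ⊗[k] C) (d : C), LinearMap.mul' k A (TensorProduct.map f g s) • F d =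
      smulMap f (smulMap g F) (TensorProduct.assoc k C C C (s ⊗ₜ d)) := fun s d => by
    induction s using TensorProduct.induction_on with
    | zero => simp
    | add t₁ t₂ h₁ h₂ => simp only [map_add, add_smul, TensorProduct.add_tmul, h₁, h₂]
    | tmul a b => simp [mul_smul]
  have h₂ : ∀ t : C ⊗[k] C, smulMap (toConv f * toConv g).ofConv F t =
      smulMap f (smulMap g F) (TensorProduct.assoc k C C C (comul.rTensor C t)) := fun t => by
    induction t using TensorProduct.induction_on with
    | zero => simp
    | add t₁ t₂ h₁ h₂ => simp only [map_add, h₁, h₂]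
    | tmul c d => simpa using h₃ (comul c) d
  ext c
  rw [convSMul_apply, convSMul_apply, h₁, h₂, Coalgebra.coassoc_apply]

lemma one_convSMul (F : C →ₗ[k] P) :
    convSMul (1 : WithConv (C →ₗ[k] A)).ofConv F = F := by
  ext c
  have h : ∀ t : C ⊗[k] C, smulMap (1 : WithConv (C →ₗ[k] A)).ofConv F t =
      F (TensorProduct.lid k C (counit.rTensor C t)) := fun t => by
    induction t using TensorProduct.induction_on with
    | zero => simp
    | add t₁ t₂ h₁ h₂ => simp only [map_add, h₁, h₂]
    | tmul c d => simp
  rw [convSMul_apply, h, Coalgebra.rTensor_counit_comul, TensorProduct.lid_tmul, one_smul]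

/-- For a right `A`-module `M` and `f : C → A`, the map `m ⊗ c ↦ m f(c)`. -/
def rightEval (M : Type*) [AddCommGroup M] [Module k M] [Module Aᵐᵒᵖ M] [IsScalarTower k Aᵐᵒᵖ M]
    (f : C →ₗ[k] A) : M ⊗[k] C →ₗ[k] M :=
  TensorProduct.lift ((rightAct k A M).compl₂ f)

variable {M : Type*} [AddCommGroup M] [Module k M] [Module Aᵐᵒᵖ M] [IsScalarTower k Aᵐᵒᵖ M]

omit [Coalgebra k C] in
@[simp] lemma rightEval_tmul (f : C →ₗ[k] A) (m : M) (c : C) :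
    rightEval M f (m ⊗ₜ c) = MulOpposite.op (f c) • m := rfl

lemma rightEval_assoc_symm (f g : C →ₗ[k] A) (t : M ⊗[k] C) :
    rightEval M g ((rightEval M f).rTensor C
      ((TensorProduct.assoc k M C C).symm (comul.lTensor M t))) =
    rightEval M (toConv f * toConv g).ofConv t := by
  induction t using TensorProduct.induction_on with
  | zero => simp
  | add t₁ t₂ h₁ h₂ => simp only [map_add, h₁, h₂]
  | tmul m c =>
    have h : ∀ s : C ⊗[k] C, rightEval M g ((rightEval M f).rTensor C
        ((TensorProduct.assoc k M C C).symm (m ⊗ₜ s))) =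
        MulOpposite.op (LinearMap.mul' k A (TensorProduct.map f g s)) • m := fun s => by
      induction s using TensorProduct.induction_on with
      | zero => simp
      | add t₁ t₂ h₁ h₂ =>
        simp only [map_add, TensorProduct.tmul_add, MulOpposite.op_add, add_smul, h₁, h₂]
      | tmul a b => simp [mul_smul]
    simpa using h (comul c)

lemma rightEval_one (t : M ⊗[k] C) : rightEval M (1 : WithConv (C →ₗ[k] A)).ofConv t =
    TensorProduct.rid k M (counit.lTensor M t) := by
  induction t using TensorProduct.induction_on with
  | zero => simp
  | add t₁ t₂ h₁ h₂ => simp only [map_add, h₁, h₂]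
  | tmul m c =>
    simp only [rightEval_tmul, LinearMap.convOne_apply, LinearMap.lTensor_tmul,
      TensorProduct.rid_tmul]
    rw [Algebra.algebraMap_eq_smul_one, MulOpposite.op_smul, smul_assoc, MulOpposite.op_one,
      one_smul]

end Convolution

/-! ### Duality between `Q'` and colinear maps. -/

variable {k : Type uk} {A : Type uA} {C : Type uC} [CommRing k] [Ring A] [Algebra k A]
  [AddCommGroup C] [Module k C] [Coalgebra k C] (E : Entwining k A C) {x : C}

omit [Coalgebra k C] in
lemma rTensor_mulLeft (a : A) (t : A ⊗[k] C) :
    (LinearMap.mulLeft k a).rTensor C t = a • t := by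
  induction t using TensorProduct.induction_on with
  | zero => simp
  | add t₁ t₂ h₁ h₂ => simp only [map_add, smul_add, h₁, h₂]
  | tmul b c => simp [TensorProduct.smul_tmul']

lemma twistAct_tmul_eq_smul (b : A) (c : C) (a : A) :
    E.twistAct A ((b ⊗ₜ c) ⊗ₜ a) = b • E.ψ (c ⊗ₜ a) := by
  rw [twistAct_tmul_self, rTensor_mulLeft]

lemma twistAct_tmul {M : Type*} [AddCommGroup M] [Module k M] [Module Aᵐᵒᵖ M]
    [IsScalarTower k Aᵐᵒᵖ M] (m : M) (c : C) (a : A) :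
    E.twistAct M ((m ⊗ₜ c) ⊗ₜ a) = (rightAct k A M m).rTensor C (E.ψ (c ⊗ₜ a)) := by
  simp only [twistAct, LinearMap.coe_comp, Function.comp_apply,
    LinearEquiv.coe_coe, TensorProduct.assoc_tmul, LinearMap.lTensor_tmul]
  induction E.ψ (c ⊗ₜ a) using TensorProduct.induction_on with
  | zero => simp
  | add t₁ t₂ h₁ h₂ => simp only [map_add, TensorProduct.tmul_add, h₁, h₂]
  | tmul a'' c' => simp

/-- `c ↦ f(c₂)_ψ ⊗ c₁^ψ`. -/
def twistComul (f : C →ₗ[k] A) : C →ₗ[k] A ⊗[k] C := E.ψ ∘ₗ f.lTensor C ∘ₗ comul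

/-- Multiplicativity of `ψ` and coassociativity give `(f(c₂) g(c₃))_ψ ⊗ c₁^ψ = f(c₂)_ψ g(c₃)_Ψ ⊗
c₁^{ψΨ}`. -/
lemma twistComul_mul (f g : C →ₗ[k] A) (c : C) :
    E.twistComul (toConv f * toConv g).ofConv c =
      E.twistAct A (TensorProduct.map (E.twistComul f) g (comul c)) := by
  have h₁ : ∀ t : C ⊗[k] C, (toConv f * toConv g).ofConv.lTensor C t =
      (LinearMap.mul' k A ∘ₗ TensorProduct.map f g).lTensor C (comul.lTensor C t) := fun t => by
    induction t using TensorProduct.induction_on with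
    | zero => simp
    | add t₁ t₂ h₁ h₂ => simp only [map_add, h₁, h₂]
    | tmul c d => simp
  have h₃ : ∀ (s : C ⊗[k] C) (d : C),
      E.ψ ((LinearMap.mul' k A ∘ₗ TensorProduct.map f g).lTensor C
        (TensorProduct.assoc k C C C (s ⊗ₜ d))) =
      E.twistAct A (E.ψ (f.lTensor C s) ⊗ₜ g d) := fun s d => by
    induction s using TensorProduct.induction_on with
    | zero => simp
    | add t₁ t₂ h₁ h₂ => simp only [map_add, TensorProduct.add_tmul, h₁, h₂]
    | tmul a b => simp [ψ_mul_apply]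
  have h₂ : ∀ t : C ⊗[k] C, E.twistAct A (TensorProduct.map (E.twistComul f) g t) =
      E.ψ ((LinearMap.mul' k A ∘ₗ TensorProduct.map f g).lTensor C
        (TensorProduct.assoc k C C C (comul.rTensor C t))) := fun t => by
    induction t using TensorProduct.induction_on with
    | zero => simp
    | add t₁ t₂ h₁ h₂ => simp only [map_add, h₁, h₂]
    | tmul c d =>
      simp only [LinearMap.rTensor_tmul, h₃, TensorProduct.map_tmul]
      rfl
  rw [h₂, Coalgebra.coassoc_apply, ← h₁]
  rfl

lemma twistComul_one (c : C) :
    E.twistComul (1 : WithConv (C →ₗ[k] A)).ofConv c = 1 ⊗ₜ c := by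
  have h : ∀ t : C ⊗[k] C, E.ψ ((1 : WithConv (C →ₗ[k] A)).ofConv.lTensor C t) =
      1 ⊗ₜ TensorProduct.rid k C (counit.lTensor C t) := fun t => by
    induction t using TensorProduct.induction_on with
    | zero => simp
    | add t₁ t₂ h₁ h₂ => simp only [map_add, TensorProduct.tmul_add, h₁, h₂]
    | tmul c d =>
      simp only [LinearMap.lTensor_tmul, LinearMap.convOne_apply, TensorProduct.rid_tmul]
      rw [Algebra.algebraMap_eq_smul_one, TensorProduct.tmul_smul, map_smul, E.ψ_one,
        TensorProduct.tmul_smul]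
  refine (h (comul c)).trans ?_
  rw [Coalgebra.lTensor_counit_comul, TensorProduct.rid_tmul, one_smul]

lemma mem_Q'_iff (q : C →ₗ[k] A) : q ∈ E.Q' x ↔ ∀ c, E.twistComul q c = q c ⊗ₜ x := Iff.rfl

variable (x) in
/-- A right `C`-colinear map `C → A`. -/
def IsColinear (f : C →ₗ[k] A) : Prop := ∀ c, E.coactA x (f c) = f.rTensor C (comul c)

/-- In `twistComul_mul`, membership in `Q'` replaces `twistComul f` by `f(c₁) ⊗ x`, and acting on
this by `g(c₂)` produces `f(c₁) ρ(g(c₂))`. -/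
lemma convSMul_coactA_of_mem_Q' {f : C →ₗ[k] A} (hf : f ∈ E.Q' x) (g : C →ₗ[k] A) :
    convSMul f (E.coactA x ∘ₗ g) = E.twistComul (toConv f * toConv g).ofConv := by
  ext c
  rw [twistComul_mul, convSMul_apply]
  induction comul (R := k) c using TensorProduct.induction_on with
  | zero => simp
  | add t₁ t₂ h₁ h₂ => simp only [map_add, h₁, h₂]
  | tmul a b => simp [(E.mem_Q'_iff f).1 hf a, twistAct_tmul_eq_smul]

/-- The left side is `g(c₁) f(c₃)_ψ ⊗ c₂^ψ`. Colinearity recognises `g(c₁) ⊗ c₂` as the coaction of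
`g`, and multiplicativity of `ψ` then gives `ρ(g(c₁) f(c₂))`. -/
lemma convSMul_twistComul_of_isColinear {g : C →ₗ[k] A} (hg : E.IsColinear x g) (f : C →ₗ[k] A) :
    convSMul g (E.twistComul f) = E.coactA x ∘ₗ (toConv g * toConv f).ofConv := by
  ext c
  have h₁ : ∀ t : C ⊗[k] C, smulMap g (E.twistComul f) t =
      smulMap g (E.ψ ∘ₗ f.lTensor C) (comul.lTensor C t) := fun t => by
    induction t using TensorProduct.induction_on with
    | zero => simp
    | add t₁ t₂ h₁ h₂ => simp only [map_add, h₁, h₂]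
    | tmul c d => simp [twistComul]
  have h₃ : ∀ (s : C ⊗[k] C) (d : C), smulMap g (E.ψ ∘ₗ f.lTensor C)
      (TensorProduct.assoc k C C C (s ⊗ₜ d)) = E.twistAct A (g.rTensor C s ⊗ₜ f d) := fun s d => by
    induction s using TensorProduct.induction_on with
    | zero => simp
    | add t₁ t₂ h₁ h₂ => simp only [map_add, TensorProduct.add_tmul, h₁, h₂]
    | tmul a b => simp [twistAct_tmul_eq_smul]
  have h₂ : ∀ t : C ⊗[k] C, smulMap g (E.ψ ∘ₗ f.lTensor C)
      (TensorProduct.assoc k C C C (comul.rTensor C t)) =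
      E.coactA x (LinearMap.mul' k A (TensorProduct.map g f t)) := fun t => by
    induction t using TensorProduct.induction_on with
    | zero => simp
    | add t₁ t₂ h₁ h₂ => simp only [map_add, h₁, h₂]
    | tmul c d =>
      simp only [LinearMap.rTensor_tmul, h₃, TensorProduct.map_tmul, LinearMap.mul'_apply,
        coactA_apply, ψ_mul_apply]
      rw [← hg, coactA_apply]
  rw [convSMul_apply, h₁, ← Coalgebra.coassoc_apply, h₂]
  rfl

/-- Since `l * m = 1`, convolving `l` with `ρ ∘ m` gives `twistComul 1`, which is `c ↦ 1 ⊗ c`.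
Convolving with `m` on the left cancels `l` and leaves `ρ(m(c)) = m(c₁) ⊗ c₂`. -/
lemma isColinear_of_mem_Q' {l m : C →ₗ[k] A} (hl : l ∈ E.Q' x) (hlm : toConv l * toConv m = 1)
    (hml : toConv m * toConv l = 1) : E.IsColinear x m := fun c => by
  have h := E.convSMul_coactA_of_mem_Q' hl m
  have h' := congrArg (fun F => convSMul m F c) h
  simp only [convSMul_assoc, hlm, hml, one_convSMul, LinearMap.comp_apply] at h'
  rw [h', convSMul_apply]
  induction comul (R := k) c using TensorProduct.induction_on with
  | zero => simp
  | add t₁ t₂ h₁ h₂ => simp only [map_add, h₁, h₂]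
  | tmul a b => simp [twistComul_one, TensorProduct.smul_tmul']

/-- The mirror argument: convolving `m` with `twistComul l` gives `ρ ∘ (m * l) = ρ ∘ 1`, that is `c
↦ ε(c) 1 ⊗ x`. Convolving with `l` on the left cancels `m` and leaves `l(c) ⊗ x`. -/
lemma mem_Q'_of_isColinear {l m : C →ₗ[k] A} (hm : E.IsColinear x m)
    (hlm : toConv l * toConv m = 1) (hml : toConv m * toConv l = 1) : l ∈ E.Q' x := by
  rw [mem_Q'_iff]
  intro c
  have h := E.convSMul_twistComul_of_isColinear hm l
  have h' := congrArg (fun F => convSMul l F c) h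
  simp only [convSMul_assoc, hlm, hml, one_convSMul] at h'
  have e : E.coactA x ∘ₗ (1 : WithConv (C →ₗ[k] A)).ofConv =
      (TensorProduct.mk k A C).flip x ∘ₗ (1 : WithConv (C →ₗ[k] A)).ofConv := by
    ext d
    simp [Algebra.algebraMap_eq_smul_one, E.ψ_one, TensorProduct.smul_tmul']
  have e' : ∀ t : C ⊗[k] C,
      smulMap l ((TensorProduct.mk k A C).flip x ∘ₗ (1 : WithConv (C →ₗ[k] A)).ofConv) t =
        LinearMap.mul' k A (TensorProduct.map l (1 : WithConv (C →ₗ[k] A)).ofConv t) ⊗ₜ x :=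
    fun t => by
    induction t using TensorProduct.induction_on with
    | zero => simp
    | add t₁ t₂ h₁ h₂ => simp only [map_add, TensorProduct.add_tmul, h₁, h₂]
    | tmul a b => simp [TensorProduct.smul_tmul']
  rw [h', e, convSMul_apply, e']
  exact congrArg (fun F : WithConv (C →ₗ[k] A) => F.ofConv c ⊗ₜ[k] x) (mul_one (toConv l))

lemma isCleft_iff : E.IsCleft x ↔ ∃ l m : C →ₗ[k] A, l ∈ E.Q' x ∧ E.IsColinear x m ∧
    toConv l * toConv m = 1 ∧ toConv m * toConv l = 1 := by
  constructor
  · rintro ⟨l, hl, u, hu⟩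
    have h₁ : toConv l * toConv (u⁻¹).val.ofConv = 1 := by simp [← hu]
    have h₂ : toConv (u⁻¹).val.ofConv * toConv l = 1 := by simp [← hu]
    exact ⟨l, _, hl, E.isColinear_of_mem_Q' hl h₁ h₂, h₁, h₂⟩
  · rintro ⟨l, m, hl, -, h₁, h₂⟩
    exact ⟨l, hl, ⟨⟨_, _, h₁, h₂⟩, rfl⟩⟩

lemma isCleft_of_isColinear {m : C →ₗ[k] A} (hm : E.IsColinear x m)
    (h : Function.Bijective fun f : C →ₗ[k] A => toConv m * toConv f) : E.IsCleft x := by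
  obtain ⟨l, hl⟩ := h.2 1
  have hl : toConv m * toConv l = 1 := hl
  have h' : toConv l * toConv m = 1 := by
    -- The right inverse is two-sided: `m * (l * m) = m = m * 1`, and left convolution by `m` is
    -- injective.
    have := @h.1 (toConv l * toConv m).ofConv (1 : WithConv (C →ₗ[k] A)).ofConv (by
      simp only [toConv_ofConv]
      rw [← mul_assoc, hl, one_mul, mul_one])
    exact ofConv_injective this
  exact E.isCleft_iff.2 ⟨l, m, E.mem_Q'_of_isColinear hm h' hl, hm, h', hl⟩

/-! ### Projections onto coinvariants. -/

section EntwinedModule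

variable {E} {M : Type*} [AddCommGroup M] [Module k M] [Module Aᵐᵒᵖ M] [IsScalarTower k Aᵐᵒᵖ M]
  (D : E.EntwinedModule M)

lemma EntwinedModule.rTensor_coact (m : M) : D.coact.rTensor C (D.coact m) =
    (TensorProduct.assoc k M C C).symm (comul.lTensor M (D.coact m)) := by
  rw [LinearEquiv.eq_symm_apply]
  exact LinearMap.congr_fun D.coassoc m

lemma EntwinedModule.rightEval_rightEval (f g : C →ₗ[k] A) (m : M) :
    rightEval M g ((rightEval M f ∘ₗ D.coact).rTensor C (D.coact m)) =
      rightEval M (toConv f * toConv g).ofConv (D.coact m) := by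
  rw [LinearMap.rTensor_comp, LinearMap.comp_apply, D.rTensor_coact, rightEval_assoc_symm]

lemma EntwinedModule.rightEval_one (m : M) :
    rightEval M (1 : WithConv (C →ₗ[k] A)).ofConv (D.coact m) = m := by
  rw [Entwining.rightEval_one]
  exact LinearMap.congr_fun D.counit m

/-- Compatibility of coaction and action, followed by coassociativity, gives `ρ(m₀ l(m₁)) = m₀
l(m₂)_ψ ⊗ m₁^ψ`. The defining condition of `Q'` applied to the second leg collapses this to `m₀
l(m₁) ⊗ x`. -/
lemma EntwinedModule.coact_rightEval {l : C →ₗ[k] A} (hl : l ∈ E.Q' x) (m : M) :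
    D.coact (rightEval M l (D.coact m)) = rightEval M l (D.coact m) ⊗ₜ x := by
  have h₁ : ∀ t : M ⊗[k] C, D.coact (rightEval M l t) =
      E.twistAct M (l.lTensor (M ⊗[k] C) (D.coact.rTensor C t)) := fun t => by
    induction t using TensorProduct.induction_on with
    | zero => simp
    | add t₁ t₂ h₁ h₂ => simp only [map_add, h₁, h₂]
    | tmul m c => simp [D.coact_act]
  have h₂ : ∀ (m : M) (s : C ⊗[k] C), E.twistAct M (l.lTensor (M ⊗[k] C)
      ((TensorProduct.assoc k M C C).symm (m ⊗ₜ s))) =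
      (rightAct k A M m).rTensor C (E.ψ (l.lTensor C s)) := fun m s => by
    induction s using TensorProduct.induction_on with
    | zero => simp
    | add t₁ t₂ h₁ h₂ => simp only [map_add, TensorProduct.tmul_add, h₁, h₂]
    | tmul a b => simp [twistAct_tmul]
  have h₃ : ∀ t : M ⊗[k] C, E.twistAct M (l.lTensor (M ⊗[k] C)
      ((TensorProduct.assoc k M C C).symm (comul.lTensor M t))) = rightEval M l t ⊗ₜ x :=
    fun t => by
    induction t using TensorProduct.induction_on with
    | zero => simp
    | add t₁ t₂ h₁ h₂ => simp only [map_add, TensorProduct.add_tmul, h₁, h₂]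
    | tmul m c => simp [h₂, hl c]
  rw [h₁, D.rTensor_coact, h₃]

/-- The projection `m ↦ m₀ l(m₁)` onto the coinvariants, for `l ∈ Q'`. -/
def EntwinedModule.proj {l : C →ₗ[k] A} (hl : l ∈ E.Q' x) : M →ₗ[k] E.coinvariants x D where
  toFun m := ⟨rightEval M l (D.coact m), D.coact_rightEval hl m⟩
  map_add' m n := Subtype.ext (by simp)
  map_smul' r m := Subtype.ext (by simp)

@[simp] lemma EntwinedModule.coe_proj {l : C →ₗ[k] A} (hl : l ∈ E.Q' x) (m : M) :
    (D.proj hl m : M) = rightEval M l (D.coact m) := rfl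

end EntwinedModule

/-- The projection `a ↦ a_ψ l(x^ψ)` of `A` onto the ring of coinvariants, for `l ∈ Q'`. -/
def projA (hx : IsGroupLikeElem k x) {l : C →ₗ[k] A} (hl : l ∈ E.Q' x) :
    A →ₗ[k] E.coinvRing x where
  toFun a := ⟨rightEval A l (E.coactA x a), (E.moduleA hx).coact_rightEval hl a⟩
  map_add' a b := Subtype.ext (by simp only [map_add]; rfl)
  map_smul' r a := Subtype.ext (by simp only [map_smul]; rfl)

/-! ### The normal basis of a cleft entwining structure. -/

section ProjA

variable {E} (hx : IsGroupLikeElem k x) {l : C →ₗ[k] A} (hl : l ∈ E.Q' x)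

lemma coe_projA (a : A) : (E.projA hx hl a : A) = rightEval A l (E.coactA x a) := rfl

lemma coactA_coinv_mul (b : E.coinvRing x) (a : A) :
    E.coactA x (b * a) = (b : A) • E.coactA x a := by
  rw [coactA_mul, rTensor_mulLeft]

omit [Coalgebra k C] in
lemma rightEval_smul (f : C →ₗ[k] A) (b : A) (t : A ⊗[k] C) :
    rightEval A f (b • t) = b * rightEval A f t := by
  induction t using TensorProduct.induction_on with
  | zero => simp
  | add t₁ t₂ h₁ h₂ => simp only [map_add, smul_add, mul_add, h₁, h₂]
  | tmul a c => simp [TensorProduct.smul_tmul', mul_assoc]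

lemma projA_mul (b : E.coinvRing x) (a : A) :
    E.projA hx hl (b * a) = b * E.projA hx hl a :=
  Subtype.ext (by simp only [coe_projA, coactA_coinv_mul, rightEval_smul, MulMemClass.coe_mul])

/-- By colinearity the projection of `m(c)` is `m(c₁) l(c₂) = (m * l)(c) = ε(c)`. -/
lemma projA_of_isColinear {m : C →ₗ[k] A} (hm : E.IsColinear x m)
    (hml : toConv m * toConv l = 1) (c : C) :
    E.projA hx hl (m c) = algebraMap k _ (counit c) := by
  refine Subtype.ext ?_
  have e : ∀ t : C ⊗[k] C, rightEval A l (m.rTensor C t) =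
      LinearMap.mul' k A (TensorProduct.map m l t) := fun t => by
    induction t using TensorProduct.induction_on with
    | zero => simp
    | add t₁ t₂ h₁ h₂ => simp only [map_add, h₁, h₂]
    | tmul c d => simp
  rw [coe_projA, hm, e]
  exact congrArg (fun F : WithConv (C →ₗ[k] A) => F.ofConv c) hml

/-- The left `B'`-linear map `B' ⊗ C → A`, `b ⊗ c ↦ b m(c)`. -/
def mulMap (m : C →ₗ[k] A) : E.coinvRing x ⊗[k] C →ₗ[E.coinvRing x] A :=
  TensorProduct.AlgebraTensorModule.lift
    { toFun := fun b => b • m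
      map_add' := fun b b' => add_smul b b' m
      map_smul' := fun b b' => mul_smul b b' m }

@[simp] lemma mulMap_tmul (m : C →ₗ[k] A) (b : E.coinvRing x) (c : C) :
    mulMap m (b ⊗ₜ[k] c) = (b : A) * m c := rfl

lemma mulMap_eq_rightEval (m : C →ₗ[k] A) (t : E.coinvRing x ⊗[k] C) :
    mulMap m t = rightEval A m ((E.coinvRing x).val.toLinearMap.rTensor C t) := by
  induction t using TensorProduct.induction_on with
  | zero => simp
  | add t₁ t₂ h₁ h₂ => simp only [map_add, h₁, h₂]
  | tmul b c => simp

lemma coactA_mulMap {m : C →ₗ[k] A} (hm : E.IsColinear x m) (t : E.coinvRing x ⊗[k] C) :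
    E.coactA x (mulMap m t) = ((mulMap m).restrictScalars k).rTensor C
      ((TensorProduct.assoc k (E.coinvRing x) C C).symm (comul.lTensor (E.coinvRing x) t)) := by
  induction t using TensorProduct.induction_on with
  | zero => simp
  | add t₁ t₂ h₁ h₂ => simp only [map_add, h₁, h₂]
  | tmul b c =>
    rw [mulMap_tmul, coactA_coinv_mul, hm, LinearMap.lTensor_tmul]
    induction comul (R := k) c using TensorProduct.induction_on with
    | zero => simp
    | add t₁ t₂ h₁ h₂ => simp only [map_add, smul_add, TensorProduct.tmul_add, h₁, h₂]
    | tmul c d => simp [TensorProduct.smul_tmul']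

-- The inverse is `a ↦ a₀ l(a₁) ⊗ a₂`. One composite is the identity because `m * l = 1`, the other
-- because `l * m = 1`.
include hx in
lemma mulMap_bijective {l m : C →ₗ[k] A} (hl : l ∈ E.Q' x) (hm : E.IsColinear x m)
    (hlm : toConv l * toConv m = 1) (hml : toConv m * toConv l = 1) :
    Function.Bijective (mulMap (E := E) (x := x) m) := by
  refine Function.bijective_iff_has_inverse.2
    ⟨fun a => (E.projA hx hl).rTensor C (E.coactA x a), fun t => ?_, fun a => ?_⟩
  · have key : ∀ t : E.coinvRing x ⊗[k] C, (E.projA hx hl).rTensor C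
        (((mulMap m).restrictScalars k).rTensor C
        ((TensorProduct.assoc k (E.coinvRing x) C C).symm
          (comul.lTensor (E.coinvRing x) t))) = t := fun t => by
      induction t using TensorProduct.induction_on with
      | zero => simp
      | add t₁ t₂ h₁ h₂ => simp only [map_add, h₁, h₂]
      | tmul b c =>
        -- The projection is left `B'`-linear and sends `m(c)` to `ε(c)`, so `b m(c₁) ⊗ c₂` becomes
        -- `b ⊗ ε(c₁) c₂`.
        have e : ∀ s : C ⊗[k] C, (E.projA hx hl).rTensor C
            (((mulMap m).restrictScalars k).rTensor C
            ((TensorProduct.assoc k (E.coinvRing x) C C).symm (b ⊗ₜ s))) =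
            b ⊗ₜ TensorProduct.lid k C (counit.rTensor C s) := fun s => by
          induction s using TensorProduct.induction_on with
          | zero => simp
          | add t₁ t₂ h₁ h₂ => simp only [map_add, TensorProduct.tmul_add, h₁, h₂]
          | tmul c d =>
            simp only [TensorProduct.assoc_symm_tmul, LinearMap.rTensor_tmul,
              LinearMap.restrictScalars_apply, mulMap_tmul, projA_mul,
              projA_of_isColinear hx hl hm hml, TensorProduct.lid_tmul, TensorProduct.tmul_smul]
            rw [Algebra.algebraMap_eq_smul_one, mul_smul_comm, mul_one,
              TensorProduct.smul_tmul']
        rw [LinearMap.lTensor_tmul, e, Coalgebra.rTensor_counit_comul, TensorProduct.lid_tmul,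
          one_smul]
    simp only [coactA_mulMap hm, key]
  · have h := (E.moduleA hx).rightEval_rightEval l m a
    rw [hlm, (E.moduleA hx).rightEval_one] at h
    change mulMap m ((E.projA hx hl).rTensor C (E.coactA x a)) = a
    rw [mulMap_eq_rightEval, ← LinearMap.comp_apply (LinearMap.rTensor C _),
      ← LinearMap.rTensor_comp]
    exact h

end ProjA

theorem IsCleft.rightNormalBasis (hx : IsGroupLikeElem k x) (h : E.IsCleft x) :
    E.RightNormalBasis x := by
  obtain ⟨l, m, hl, hm, hlm, hml⟩ := E.isCleft_iff.1 h
  exact ⟨LinearEquiv.ofBijective (mulMap m) (mulMap_bijective hx hl hm hlm hml),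
    fun t => coactA_mulMap hm t⟩

/-! ### Cleft implies the Strong Structure Theorem. -/

section Structure

variable {E} {M : Type*} [AddCommGroup M] [Module k M] [Module Aᵐᵒᵖ M] [IsScalarTower k Aᵐᵒᵖ M]
  (D : E.EntwinedModule M)

lemma coact_op_smul_coinv (n : E.coinvariants x D) (a : A) :
    D.coact (MulOpposite.op a • (n : M)) = (rightAct k A M n).rTensor C (E.coactA x a) := by
  rw [D.coact_act, show D.coact (n : M) = (n : M) ⊗ₜ x from n.2, twistAct_tmul, coactA_apply]

omit [Coalgebra k C] in
lemma rightEval_rTensor_rightAct (f : C →ₗ[k] A) (m : M) (t : A ⊗[k] C) :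
    rightEval M f ((rightAct k A M m).rTensor C t) = MulOpposite.op (rightEval A f t) • m := by
  induction t using TensorProduct.induction_on with
  | zero => simp
  | add t₁ t₂ h₁ h₂ => simp only [map_add, MulOpposite.op_add, add_smul, h₁, h₂]
  | tmul a c => simp [mul_smul]

/-- For `n` coinvariant, `ρ(n a) = n a_ψ ⊗ x^ψ`, so the projection only sees `a`; its value lies in
`B'` and can be moved across `⊗_{B'}`. -/
lemma proj_op_smul_coinv (hx : IsGroupLikeElem k x) {l : C →ₗ[k] A} (hl : l ∈ E.Q' x)
    (n : E.coinvariants x D) (a : A) :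
    D.proj hl (MulOpposite.op a • (n : M)) = MulOpposite.op (E.projA hx hl a) • n := by
  refine Subtype.ext ?_
  rw [D.coe_proj, coact_op_smul_coinv, rightEval_rTensor_rightAct]
  rfl

lemma counitMap_tmul (n : E.coinvariants x D) (a : A) :
    E.counitMap x D (balTmul k n a) = MulOpposite.op a • (n : M) := by
  rw [counitMap, balLift_tmul]
  rfl

/-- The inverse is `n ↦ n₀ l(n₁) ⊗ m(n₂)`. On `n a` with `n` coinvariant it gives `n ⊗ a₀ l(a₁)
m(a₂) = n ⊗ a`, and applying the counit to it gives `n₀ l(n₁) m(n₂) = n`. -/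
theorem counitMap_bijective (hx : IsGroupLikeElem k x) {l m : C →ₗ[k] A} (hl : l ∈ E.Q' x)
    (hlm : toConv l * toConv m = 1) :
    Function.Bijective (E.counitMap x D) := by
  let G : M ⊗[k] C →ₗ[k] BalTensor k (B := E.coinvRing x) (E.coinvariants x D) A :=
    TensorProduct.lift ((balMk k (B := E.coinvRing x) (E.coinvariants x D) A).compl₁₂
      (D.proj hl) m)
  have hG : ∀ n c, G (n ⊗ₜ c) = balTmul k (D.proj hl n) (m c) := fun n c => rfl
  refine Function.bijective_iff_has_inverse.2 ⟨G ∘ₗ D.coact, fun t => ?_, fun n => ?_⟩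
  · refine LinearMap.congr_fun (f := (G ∘ₗ D.coact) ∘ₗ E.counitMap x D) (g := LinearMap.id)
      (BalTensor.ext_hom fun n a => ?_) t
    have e : ∀ t : A ⊗[k] C, G ((rightAct k A M n).rTensor C t) =
        balTmul k n (rightEval A m (((E.coinvRing x).val.toLinearMap ∘ₗ E.projA hx hl).rTensor C
          t)) := fun t => by
      induction t using TensorProduct.induction_on with
      | zero => simp only [map_zero]; exact (map_zero (balMk k _ A n)).symm
      | add t₁ t₂ h₁ h₂ =>
        simp only [map_add, h₁, h₂]
        exact (map_add (balMk k _ A n) _ _).symm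
      | tmul a c =>
        rw [LinearMap.rTensor_tmul, hG, rightAct_apply, proj_op_smul_coinv D hx, balTmul_smul]
        rfl
    have h := (E.moduleA hx).rightEval_rightEval l m a
    rw [hlm, (E.moduleA hx).rightEval_one] at h
    rw [LinearMap.comp_apply, LinearMap.comp_apply, counitMap_tmul, coact_op_smul_coinv, e]
    exact congrArg (balTmul k n) h
  · have e : ∀ t : M ⊗[k] C, E.counitMap x D (G t) =
        rightEval M m ((rightEval M l ∘ₗ D.coact).rTensor C t) := fun t => by
      induction t using TensorProduct.induction_on with
      | zero => simp
      | add t₁ t₂ h₁ h₂ => simp only [map_add, h₁, h₂]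
      | tmul a c => simp [hG, counitMap_tmul]
    rw [LinearMap.comp_apply, e, D.rightEval_rightEval, hlm, D.rightEval_one]

variable {N : Type*} [AddCommGroup N] [Module k N] [Module (E.coinvRing x)ᵐᵒᵖ N]
    [IsScalarTower k (E.coinvRing x)ᵐᵒᵖ N]

/-- A left `B'`-linear map `φ : A → B'` induces `n ⊗ a ↦ n φ(a)` on `N ⊗_{B'} A`. -/
def indRetract (φ : A →ₗ[k] E.coinvRing x) (hφ : ∀ (b : E.coinvRing x) a, φ (b * a) = b * φ a) :
    E.Ind x N →ₗ[k] N :=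
  balLift (B := E.coinvRing x) ((rightAct k (E.coinvRing x) N).compl₂ φ) (fun n b a => by
    change MulOpposite.op (φ a) • MulOpposite.op b • n = MulOpposite.op (φ (b * a)) • n
    rw [hφ, smul_smul, MulOpposite.op_mul])

lemma indRetract_tmul (φ : A →ₗ[k] E.coinvRing x)
    (hφ : ∀ (b : E.coinvRing x) a, φ (b * a) = b * φ a) (n : N) (a : A) :
    indRetract φ hφ (E.indTmul x n a) = MulOpposite.op (φ a) • n := by
  unfold indRetract indTmul
  erw [balLift_tmul]
  rfl

/-- A left `B'`-linear retraction `φ` of `B' ⊆ A` induces the retraction `n ⊗ a ↦ n φ(a)` of the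
unit. It also inverts the unit from the other side, because on coinvariants the coaction reduces `l`
and `m` to `l(x) m(x) = 1`. -/
theorem unitMap_bijective (hx : IsGroupLikeElem k x) {l m : C →ₗ[k] A} (hl : l ∈ E.Q' x)
    (hm : E.IsColinear x m) (hlm : toConv l * toConv m = 1) :
    Function.Bijective (E.unitMap N hx) := by
  have hmx : m x ∈ E.coinvRing x := by
    change E.coactA x (m x) = _
    rw [hm, hx.comul_eq_tmul_self, LinearMap.rTensor_tmul]
  have hxx : ∀ f g : C →ₗ[k] A, toConv f * toConv g = 1 → f x * g x = 1 := fun f g h => by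
    have := congrArg (fun F : WithConv (C →ₗ[k] A) => F.ofConv x) h
    simpa [hx.comul_eq_tmul_self, hx.counit_eq_one] using this
  -- The projection sends `1` to `l(x)`, so right multiplication by `m(x) ∈ B'` normalises it to
  -- `φ(1) = 1`.
  let φ : A →ₗ[k] E.coinvRing x := LinearMap.mulRight k ⟨m x, hmx⟩ ∘ₗ E.projA hx hl
  have hφ : ∀ (b : E.coinvRing x) a, φ (b * a) = b * φ a := fun b a => by
    simp [φ, projA_mul, mul_assoc]
  have hφa : ∀ a, (φ a : A) = rightEval A l (E.coactA x a) * m x := fun a => rfl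
  have hφ1 : φ 1 = 1 := Subtype.ext (by simp [hφa, E.ψ_one, hxx l m hlm])
  refine Function.bijective_iff_has_inverse.2
    ⟨fun t => indRetract φ hφ (t : E.Ind x N), fun n => ?_, fun t => Subtype.ext ?_⟩
  · simp [unitMap, indRetract_tmul, hφ1]
  · change E.indTmul x (indRetract φ hφ (t : E.Ind x N)) 1 = t
    -- On `n ⊗ a` both sides are `n ⊗ a₀ l(a₁) m(x)`, as `φ(a) ∈ B'` passes through the tensor sign.
    have key : ∀ t : E.Ind x N, E.indTmul x (indRetract φ hφ t) 1 =
        MulOpposite.op (m x) • rightEval _ l (E.indCoact x N t) := fun t => by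
      refine LinearMap.congr_fun
        (f := (show N →ₗ[k] A →ₗ[k] E.Ind x N from balMk k (B := E.coinvRing x) N A).flip 1 ∘ₗ
          indRetract φ hφ)
        (g := E.indMul x N (m x) ∘ₗ rightEval _ l ∘ₗ E.indCoact x N)
        (ind_ext fun n a => ?_) t
      have e : ∀ s : A ⊗[k] C, rightEval (E.Ind x N) l ((E.indMk x n).rTensor C s) =
          E.indTmul x n (rightEval A l s) := fun s => by
        induction s using TensorProduct.induction_on with
        | zero => simp [indTmul_zero]
        | add t₁ t₂ h₁ h₂ => simp only [map_add, indTmul_add, h₁, h₂]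
        | tmul a c => simp
      simp only [LinearMap.comp_apply, indRetract_tmul, indCoact_tmul, e, indMul_tmul]
      change E.indTmul x (MulOpposite.op (φ a) • n) 1 = _
      rw [indTmul_smul, mul_one, hφa, coactA_apply]
    have ht : E.indCoact x N (t : E.Ind x N) = (t : E.Ind x N) ⊗ₜ x := t.2
    rw [key, ht, rightEval_tmul, smul_smul, ← MulOpposite.op_mul, hxx l m hlm,
      MulOpposite.op_one, one_smul]

end Structure

theorem IsCleft.strongStructure (hx : IsGroupLikeElem k x) (h : E.IsCleft x) :
    StrongStructure.{uk, uA, uC, w} E hx := by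
  obtain ⟨l, m, hl, hm, hlm, -⟩ := E.isCleft_iff.1 h
  exact ⟨fun M _ _ _ _ D => counitMap_bijective D hx hl hlm,
    fun N _ _ _ _ => unitMap_bijective hx hl hm hlm⟩

/-! ### The entwined module `A ⊗ C`, and Weak Structure implies Galois. -/

section Cofree

lemma twistAct_A_smul (b : A) (t : A ⊗[k] C) (a : A) :
    E.twistAct A ((b • t) ⊗ₜ a) = b • E.twistAct A (t ⊗ₜ a) := by
  rw [← rTensor_mulLeft, twistAct_smul, rTensor_mulLeft]

lemma twistAct_one (t : A ⊗[k] C) : E.twistAct A (t ⊗ₜ 1) = t := by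
  induction t using TensorProduct.induction_on with
  | zero => simp
  | add t₁ t₂ h₁ h₂ => simp only [map_add, TensorProduct.add_tmul, h₁, h₂]
  | tmul b c => rw [twistAct_tmul_eq_smul, E.ψ_one, TensorProduct.smul_tmul', smul_eq_mul, mul_one]

lemma twistAct_mul (t : A ⊗[k] C) (a b : A) :
    E.twistAct A (t ⊗ₜ (a * b)) = E.twistAct A (E.twistAct A (t ⊗ₜ a) ⊗ₜ b) := by
  induction t using TensorProduct.induction_on with
  | zero => simp
  | add t₁ t₂ h₁ h₂ => simp only [map_add, TensorProduct.add_tmul, h₁, h₂]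
  | tmul c d => rw [twistAct_tmul_eq_smul, twistAct_tmul_eq_smul, ψ_mul_apply, twistAct_A_smul]

/-- The entwined module `A ⊗ C`, lifted to a larger universe. -/
@[nolint unusedArguments]
def Cofree (_ : Entwining k A C) : Type (max uA uC w) := ULift.{w} (A ⊗[k] C)

instance : AddCommGroup (Cofree.{uk, uA, uC, w} E) :=
  inferInstanceAs (AddCommGroup (ULift.{w} (A ⊗[k] C)))

instance : Module k (Cofree.{uk, uA, uC, w} E) :=
  inferInstanceAs (Module k (ULift.{w} (A ⊗[k] C)))

/-- The identification of `E.Cofree` with `A ⊗ C`. -/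
def cofreeEquiv : Cofree.{uk, uA, uC, w} E ≃ₗ[k] A ⊗[k] C := ULift.moduleEquiv

/-- The right action `(b ⊗ c) a = b a_ψ ⊗ c^ψ`. -/
instance : Module Aᵐᵒᵖ (Cofree.{uk, uA, uC, w} E) where
  smul a t := E.cofreeEquiv.symm (E.twistAct A (E.cofreeEquiv t ⊗ₜ a.unop))
  one_smul t := E.cofreeEquiv.injective (by
    change E.cofreeEquiv (E.cofreeEquiv.symm _) = _
    simp [twistAct_one])
  mul_smul a b t := E.cofreeEquiv.injective (by
    change E.cofreeEquiv (E.cofreeEquiv.symm _) = E.cofreeEquiv (E.cofreeEquiv.symm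
      (E.twistAct A (E.cofreeEquiv (E.cofreeEquiv.symm _) ⊗ₜ _)))
    simp [twistAct_mul])
  smul_zero a := by
    change E.cofreeEquiv.symm _ = _
    simp
  smul_add a s t := by
    change E.cofreeEquiv.symm _ = E.cofreeEquiv.symm _ + E.cofreeEquiv.symm _
    simp [TensorProduct.add_tmul]
  add_smul a b t := by
    change E.cofreeEquiv.symm _ = E.cofreeEquiv.symm _ + E.cofreeEquiv.symm _
    simp [TensorProduct.tmul_add]
  zero_smul t := by
    change E.cofreeEquiv.symm _ = _
    simp

lemma cofreeEquiv_op_smul (a : A) (t : Cofree.{uk, uA, uC, w} E) :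
    E.cofreeEquiv (MulOpposite.op a • t) = E.twistAct A (E.cofreeEquiv t ⊗ₜ a) :=
  E.cofreeEquiv.apply_symm_apply _

instance : IsScalarTower k Aᵐᵒᵖ (Cofree.{uk, uA, uC, w} E) where
  smul_assoc r a t := E.cofreeEquiv.injective (by
    rw [← MulOpposite.op_unop a, ← MulOpposite.op_smul, cofreeEquiv_op_smul, map_smul,
      cofreeEquiv_op_smul, TensorProduct.tmul_smul, map_smul])

/-- The coaction `id ⊗ Δ` on `A ⊗ C`. -/
def cofreeCoact : A ⊗[k] C →ₗ[k] (A ⊗[k] C) ⊗[k] C :=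
  (TensorProduct.assoc k A C C).symm.toLinearMap ∘ₗ comul.lTensor A

lemma rTensor_cofreeCoact (t : A ⊗[k] C) :
    TensorProduct.assoc k (A ⊗[k] C) C C (cofreeCoact.rTensor C (cofreeCoact t)) =
      comul.lTensor (A ⊗[k] C) (cofreeCoact t) := by
  induction t using TensorProduct.induction_on with
  | zero => simp
  | add t₁ t₂ h₁ h₂ => simp only [map_add, h₁, h₂]
  | tmul a c =>
    let Φ : C ⊗[k] (C ⊗[k] C) →ₗ[k] (A ⊗[k] C) ⊗[k] (C ⊗[k] C) :=
      (TensorProduct.mk k A C a).rTensor (C ⊗[k] C)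
    have e₁ : ∀ s : C ⊗[k] C, TensorProduct.assoc k (A ⊗[k] C) C C (cofreeCoact.rTensor C
        ((TensorProduct.assoc k A C C).symm (a ⊗ₜ s))) =
        Φ (TensorProduct.assoc k C C C (comul.rTensor C s)) := fun s => by
      induction s using TensorProduct.induction_on with
      | zero => simp
      | add t₁ t₂ h₁ h₂ => simp only [map_add, TensorProduct.tmul_add, h₁, h₂]
      | tmul c d =>
        simp only [TensorProduct.assoc_symm_tmul, LinearMap.rTensor_tmul, cofreeCoact,
          LinearMap.comp_apply, LinearEquiv.coe_coe, LinearMap.lTensor_tmul]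
        induction comul (R := k) c using TensorProduct.induction_on with
        | zero => simp
        | add t₁ t₂ h₁ h₂ =>
          simp only [map_add, TensorProduct.tmul_add, TensorProduct.add_tmul, h₁, h₂]
        | tmul c d => simp [Φ]
    have e₂ : ∀ s : C ⊗[k] C, comul.lTensor (A ⊗[k] C)
        ((TensorProduct.assoc k A C C).symm (a ⊗ₜ s)) = Φ (comul.lTensor C s) := fun s => by
      induction s using TensorProduct.induction_on with
      | zero => simp
      | add t₁ t₂ h₁ h₂ => simp only [map_add, TensorProduct.tmul_add, h₁, h₂]
      | tmul c d => simp [Φ]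
    have e₃ : cofreeCoact (a ⊗ₜ[k] c) = (TensorProduct.assoc k A C C).symm (a ⊗ₜ comul c) := rfl
    rw [e₃, e₁, e₂, Coalgebra.coassoc_apply]

lemma rid_lTensor_counit_cofreeCoact (t : A ⊗[k] C) :
    TensorProduct.rid k (A ⊗[k] C) (counit.lTensor (A ⊗[k] C) (cofreeCoact t)) = t := by
  induction t using TensorProduct.induction_on with
  | zero => simp
  | add t₁ t₂ h₁ h₂ => simp only [map_add, h₁, h₂]
  | tmul a c =>
    have e : ∀ s : C ⊗[k] C, TensorProduct.rid k (A ⊗[k] C) (counit.lTensor (A ⊗[k] C)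
        ((TensorProduct.assoc k A C C).symm (a ⊗ₜ s))) =
        a ⊗ₜ TensorProduct.rid k C (counit.lTensor C s) := fun s => by
      induction s using TensorProduct.induction_on with
      | zero => simp
      | add t₁ t₂ h₁ h₂ => simp only [map_add, TensorProduct.tmul_add, h₁, h₂]
      | tmul c d => simp
    refine (e (comul c)).trans ?_
    rw [Coalgebra.lTensor_counit_comul, TensorProduct.rid_tmul, one_smul]

lemma cofreeCoact_smul (b : A) (t : A ⊗[k] C) : cofreeCoact (b • t) = b • cofreeCoact t := by
  induction t using TensorProduct.induction_on with
  | zero => simp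
  | add t₁ t₂ h₁ h₂ => simp only [map_add, smul_add, h₁, h₂]
  | tmul a c =>
    simp only [TensorProduct.smul_tmul', cofreeCoact, LinearMap.comp_apply, LinearEquiv.coe_coe,
      LinearMap.lTensor_tmul]
    induction comul (R := k) c using TensorProduct.induction_on with
    | zero => simp
    | add t₁ t₂ h₁ h₂ => simp only [map_add, smul_add, TensorProduct.tmul_add, h₁, h₂]
    | tmul c d => simp [TensorProduct.smul_tmul']

lemma cofreeCoact_ψ (c : C) (a : A) : cofreeCoact (E.ψ (c ⊗ₜ a)) =
    E.ψ.rTensor C ((TensorProduct.assoc k C A C).symm (E.ψ.lTensor C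
      (TensorProduct.assoc k C C A (comul c ⊗ₜ a)))) := by
  rw [cofreeCoact, LinearMap.comp_apply, LinearEquiv.coe_coe, LinearEquiv.symm_apply_eq]
  exact LinearMap.congr_fun E.ψ_comul (c ⊗ₜ a)

/-- The entwined module condition for `A ⊗ C`. By left `A`-linearity it reduces to the compatibility
of `ψ` with `Δ`. -/
lemma twistAct_cofree (t : A ⊗[k] C) (a : A) :
    E.cofreeEquiv.toLinearMap.rTensor C (E.twistAct (Cofree.{uk, uA, uC, w} E)
      (E.cofreeEquiv.symm.toLinearMap.rTensor C (cofreeCoact t) ⊗ₜ a)) =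
    cofreeCoact (E.twistAct A (t ⊗ₜ a)) := by
  induction t using TensorProduct.induction_on with
  | zero => simp
  | add t₁ t₂ h₁ h₂ => simp only [map_add, TensorProduct.add_tmul, h₁, h₂]
  | tmul b c =>
    rw [twistAct_tmul_eq_smul, cofreeCoact_smul, cofreeCoact_ψ]
    have e₃ : cofreeCoact (b ⊗ₜ[k] c) = (TensorProduct.assoc k A C C).symm (b ⊗ₜ comul c) := rfl
    rw [e₃]
    induction comul (R := k) c using TensorProduct.induction_on with
    | zero => simp
    | add t₁ t₂ h₁ h₂ =>
      simp only [map_add, smul_add, TensorProduct.tmul_add, TensorProduct.add_tmul, h₁, h₂]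
    | tmul c d =>
      simp only [TensorProduct.assoc_symm_tmul, LinearMap.rTensor_tmul, twistAct_tmul,
        TensorProduct.assoc_tmul, LinearMap.lTensor_tmul]
      induction E.ψ (d ⊗ₜ a) using TensorProduct.induction_on with
      | zero => simp
      | add t₁ t₂ h₁ h₂ => simp only [map_add, smul_add, TensorProduct.tmul_add, h₁, h₂]
      | tmul a' c' =>
        simp [cofreeEquiv_op_smul, twistAct_tmul_eq_smul, TensorProduct.smul_tmul']

lemma rTensor_cofreeEquiv_injective :
    Function.Injective ((cofreeEquiv.{uk, uA, uC, w} E).toLinearMap.rTensor C) :=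
  (LinearEquiv.rTensor C E.cofreeEquiv).injective

lemma rTensor_cofreeEquiv_symm (t : (A ⊗[k] C) ⊗[k] C) :
    E.cofreeEquiv.toLinearMap.rTensor C
      ((cofreeEquiv.{uk, uA, uC, w} E).symm.toLinearMap.rTensor C t) = t :=
  (LinearEquiv.rTensor C E.cofreeEquiv).apply_symm_apply t

/-- `A ⊗ C` as an entwined module. -/
def cofreeModule : E.EntwinedModule (Cofree.{uk, uA, uC, w} E) where
  coact := E.cofreeEquiv.symm.toLinearMap.rTensor C ∘ₗ cofreeCoact ∘ₗ E.cofreeEquiv.toLinearMap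
  coassoc := by
    ext t
    have e₁ : ∀ s : (A ⊗[k] C) ⊗[k] C, TensorProduct.assoc k (Cofree.{uk, uA, uC, w} E) C C
        ((E.cofreeEquiv.symm.toLinearMap.rTensor C ∘ₗ cofreeCoact ∘ₗ
          E.cofreeEquiv.toLinearMap).rTensor C (E.cofreeEquiv.symm.toLinearMap.rTensor C s)) =
        E.cofreeEquiv.symm.toLinearMap.rTensor (C ⊗[k] C)
          (TensorProduct.assoc k (A ⊗[k] C) C C (cofreeCoact.rTensor C s)) := fun s => by
      induction s using TensorProduct.induction_on with
      | zero => simp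
      | add t₁ t₂ h₁ h₂ => simp only [map_add, h₁, h₂]
      | tmul t c =>
        simp only [LinearMap.rTensor_tmul, LinearMap.comp_apply, LinearEquiv.coe_coe,
          LinearEquiv.apply_symm_apply]
        induction cofreeCoact t using TensorProduct.induction_on with
        | zero => simp
        | add t₁ t₂ h₁ h₂ => simp only [map_add, TensorProduct.add_tmul, h₁, h₂]
        | tmul a d => simp
    have e₂ : ∀ s : (A ⊗[k] C) ⊗[k] C, comul.lTensor (Cofree.{uk, uA, uC, w} E)
        (E.cofreeEquiv.symm.toLinearMap.rTensor C s) =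
        E.cofreeEquiv.symm.toLinearMap.rTensor (C ⊗[k] C)
          (comul.lTensor (A ⊗[k] C) s) := fun s => by
      induction s using TensorProduct.induction_on with
      | zero => simp
      | add t₁ t₂ h₁ h₂ => simp only [map_add, h₁, h₂]
      | tmul t c => simp
    refine (e₁ _).trans (Eq.trans ?_ (e₂ _).symm)
    rw [LinearMap.comp_apply, rTensor_cofreeCoact]
  counit := by
    ext t
    have e : ∀ s : (A ⊗[k] C) ⊗[k] C, TensorProduct.rid k (Cofree.{uk, uA, uC, w} E)
        (counit.lTensor _ (E.cofreeEquiv.symm.toLinearMap.rTensor C s)) =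
        E.cofreeEquiv.symm (TensorProduct.rid k _ (counit.lTensor _ s)) := fun s => by
      induction s using TensorProduct.induction_on with
      | zero => simp
      | add t₁ t₂ h₁ h₂ => simp only [map_add, h₁, h₂]
      | tmul a c => simp
    simp [e, rid_lTensor_counit_cofreeCoact]
  coact_act m a := E.rTensor_cofreeEquiv_injective (by
    simp only [LinearMap.comp_apply, LinearEquiv.coe_coe, twistAct_cofree,
      rTensor_cofreeEquiv_symm, cofreeEquiv_op_smul])

lemma mem_coinvariants_cofree (t : Cofree.{uk, uA, uC, w} E) :
    t ∈ E.coinvariants x E.cofreeModule ↔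
      cofreeCoact (E.cofreeEquiv t) = E.cofreeEquiv t ⊗ₜ x := by
  refine E.rTensor_cofreeEquiv_injective.eq_iff.symm.trans ?_
  rw [LinearMap.rTensor_tmul, LinearEquiv.coe_coe]
  exact Iff.of_eq (congrArg (· = _) (E.rTensor_cofreeEquiv_symm _))

/-- The isomorphism `a ↦ a ⊗ x` of `A` with the coinvariants of `A ⊗ C`. -/
def toCofreeCoinvariants (hx : IsGroupLikeElem k x) :
    A →ₗ[k] E.coinvariants x (cofreeModule.{uk, uA, uC, w} E) where
  toFun a := ⟨E.cofreeEquiv.symm (a ⊗ₜ x), by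
    rw [mem_coinvariants_cofree, LinearEquiv.apply_symm_apply, cofreeCoact]
    simp [hx.comul_eq_tmul_self]⟩
  map_add' a b := Subtype.ext (by simp [TensorProduct.add_tmul])
  map_smul' r a := Subtype.ext (by simp [← TensorProduct.smul_tmul'])

/-- The inverse is `id ⊗ ε`: applying `(id ⊗ ε) ⊗ id` to `(id ⊗ Δ)(t) = t ⊗ x` gives `t = (id ⊗
ε)(t) ⊗ x`. -/
lemma toCofreeCoinvariants_bijective (hx : IsGroupLikeElem k x) :
    Function.Bijective (toCofreeCoinvariants.{uk, uA, uC, w} E hx) := by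
  refine Function.bijective_iff_has_inverse.2
    ⟨fun t => TensorProduct.rid k A (counit.lTensor A (E.cofreeEquiv t)), fun a => ?_,
      fun t => Subtype.ext (E.cofreeEquiv.injective ?_)⟩
  · simp [toCofreeCoinvariants, hx.counit_eq_one]
  · have ht := (E.mem_coinvariants_cofree _).1 t.2
    have e : ∀ s : A ⊗[k] C, (LinearMap.rTensor C ((TensorProduct.rid k A).toLinearMap ∘ₗ
        counit.lTensor A)) (cofreeCoact s) = s := fun s => by
      induction s using TensorProduct.induction_on with
      | zero => simp
      | add t₁ t₂ h₁ h₂ => simp only [map_add, h₁, h₂]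
      | tmul a c =>
        have e : ∀ s : C ⊗[k] C, (LinearMap.rTensor C ((TensorProduct.rid k A).toLinearMap ∘ₗ
            counit.lTensor A)) ((TensorProduct.assoc k A C C).symm (a ⊗ₜ s)) =
            a ⊗ₜ TensorProduct.lid k C (counit.rTensor C s) := fun s => by
          induction s using TensorProduct.induction_on with
          | zero => simp
          | add t₁ t₂ h₁ h₂ => simp only [map_add, TensorProduct.tmul_add, h₁, h₂]
          | tmul c d => simp [TensorProduct.smul_tmul']
        refine (e (comul c)).trans ?_
        rw [Coalgebra.rTensor_counit_comul, TensorProduct.lid_tmul, one_smul]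
    have h := e (E.cofreeEquiv t)
    rw [ht, LinearMap.rTensor_tmul] at h
    exact (E.cofreeEquiv.apply_symm_apply _).trans h

lemma toCofreeCoinvariants_smul (hx : IsGroupLikeElem k x) (b : E.coinvRing x) (a : A) :
    toCofreeCoinvariants.{uk, uA, uC, w} E hx (MulOpposite.op b • a) =
      MulOpposite.op b • E.toCofreeCoinvariants hx a := by
  refine Subtype.ext (E.cofreeEquiv.injective ?_)
  change cofreeEquiv.{uk, uA, uC, w} E (E.cofreeEquiv.symm ((a * (b : A)) ⊗ₜ x)) =
    E.cofreeEquiv (MulOpposite.op (b : A) •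
      (cofreeEquiv.{uk, uA, uC, w} E).symm (a ⊗ₜ x))
  have hb : E.ψ (x ⊗ₜ (b : A)) = (b : A) ⊗ₜ x := b.2
  rw [cofreeEquiv_op_smul, LinearEquiv.apply_symm_apply, LinearEquiv.apply_symm_apply,
    twistAct_tmul_eq_smul, hb, TensorProduct.smul_tmul', smul_eq_mul]

lemma can_tmul (a b : A) :
    E.can x (balTmul k (B := E.coinvRing x) a b) = a • E.coactA x b := by
  rw [can, balLift_tmul, ← rTensor_mulLeft]
  rfl

/-- Under `A ≅ (A ⊗ C)^{co C}`, `a ↦ a ⊗ x`, the counit of `A ⊗ C` sends `a ⊗ b` to `(a ⊗ x) b = a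
b_ψ ⊗ x^ψ`, which is `can`. -/
theorem WeakStructure.isGalois (hx : IsGroupLikeElem k x)
    (h : WeakStructure.{uk, uA, uC, w} E x) : E.IsGalois x := by
  have e : E.can x = E.cofreeEquiv.toLinearMap ∘ₗ E.counitMap x (cofreeModule.{uk, uA, uC, w} E) ∘ₗ
      balMap (E.toCofreeCoinvariants hx) (E.toCofreeCoinvariants_smul hx) := by
    refine BalTensor.ext_hom fun a b => ?_
    rw [can_tmul, LinearMap.comp_apply, LinearMap.comp_apply, balMap_tmul, counitMap_tmul,
      LinearEquiv.coe_coe, cofreeEquiv_op_smul]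
    change _ = E.twistAct A
      (E.cofreeEquiv ((cofreeEquiv.{uk, uA, uC, w} E).symm (a ⊗ₜ x)) ⊗ₜ b)
    rw [LinearEquiv.apply_symm_apply, twistAct_tmul_eq_smul, coactA_apply]
  rw [IsGalois, e]
  exact E.cofreeEquiv.bijective.comp ((h _ E.cofreeModule).comp
    (balMap_bijective _ _ (E.toCofreeCoinvariants_bijective hx)))

end Cofree

/-! ### From a normal basis back to cleftness. -/

section NormalBasis

variable {E}

/-- The right normal basis property, in terms of the image `m : C → A` of the basis. -/
lemma RightNormalBasis.exists_isColinear (h : E.RightNormalBasis x) :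
    ∃ m : C →ₗ[k] A, E.IsColinear x m ∧ Function.Bijective (mulMap (E := E) (x := x) m) := by
  obtain ⟨h, hh⟩ := h
  let m : C →ₗ[k] A := h.toLinearMap.restrictScalars k ∘ₗ TensorProduct.mk k (E.coinvRing x) C 1
  have hm : mulMap m = h.toLinearMap := by
    ext c
    simp [m]
  refine ⟨m, fun c => ?_, by rw [hm]; exact h.bijective⟩
  refine (hh (1 ⊗ₜ c)).trans ?_
  rw [LinearMap.lTensor_tmul]
  induction comul (R := k) c using TensorProduct.induction_on with
  | zero => simp
  | add t₁ t₂ h₁ h₂ => simp only [map_add, TensorProduct.tmul_add, h₁, h₂]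
  | tmul c d => simp [m]

variable {m : C →ₗ[k] A}

/-- Precomposition with `m` identifies `End_{B'}(A)` with `Hom_k(C, A)`. -/
lemma comp_bijective_of_mulMap_bijective (h : Function.Bijective (mulMap (E := E) (x := x) m)) :
    Function.Bijective fun g : Module.End (E.coinvRing x) A => g.restrictScalars k ∘ₗ m := by
  let e := LinearEquiv.ofBijective (mulMap (E := E) (x := x) m) h
  refine ⟨fun g g' hg => ?_, fun f => ⟨mulMap f ∘ₗ e.symm.toLinearMap, ?_⟩⟩
  · have hg : ∀ c, g (m c) = g' (m c) := fun c => LinearMap.congr_fun hg c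
    have : g ∘ₗ mulMap m = g' ∘ₗ mulMap m := by
      ext c
      simp [hg]
    ext a
    obtain ⟨t, rfl⟩ := h.2 a
    exact LinearMap.congr_fun this t
  · ext c
    have : e.symm (m c) = 1 ⊗ₜ c := e.injective (by
      rw [e.apply_symm_apply]
      change m c = mulMap m (1 ⊗ₜ[k] c)
      simp)
    simp [this]

/-- Colinearity turns `m(c)_ψ f(x^ψ)` into `m(c₁) f(c₂)`; in basis coordinates `*can` is left
convolution by `m`. -/
lemma starCan_comp (hm : E.IsColinear x m) (f : C →ₗ[k] A) :
    (E.starCan x f).restrictScalars k ∘ₗ m = (toConv m * toConv f).ofConv := by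
  ext c
  change LinearMap.mul' k A (f.lTensor A (E.coactA x (m c))) =
    LinearMap.mul' k A (TensorProduct.map m f (comul c))
  rw [hm, ← LinearMap.comp_apply (LinearMap.lTensor A f), LinearMap.lTensor_comp_rTensor]

lemma starCan_bijective_iff (hm : E.IsColinear x m)
    (h : Function.Bijective (mulMap (E := E) (x := x) m)) :
    Function.Bijective (E.starCan x) ↔
      Function.Bijective fun f : C →ₗ[k] A => toConv m * toConv f := by
  rw [← (comp_bijective_of_mulMap_bijective h).of_comp_iff' (E.starCan x),
    ← ofConv_bijective.of_comp_iff' fun f : C →ₗ[k] A => toConv m * toConv f]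
  exact Iff.of_eq (congrArg _ (funext fun f => starCan_comp hm f))

theorem IsCleft.starCan_bijective (hx : IsGroupLikeElem k x) (h : E.IsCleft x) :
    Function.Bijective (E.starCan x) := by
  obtain ⟨l, m, hl, hm, hlm, hml⟩ := E.isCleft_iff.1 h
  rw [starCan_bijective_iff hm (mulMap_bijective hx hl hm hlm hml)]
  refine Function.bijective_iff_has_inverse.2
    ⟨fun f => (toConv l * f).ofConv, fun f => ?_, fun f => ?_⟩
  · simp only [← mul_assoc, hlm, one_mul, ofConv_toConv]
  · simp only [toConv_ofConv, ← mul_assoc, hml, one_mul]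

theorem isCleft_of_starCan_bijective (h : Function.Bijective (E.starCan x))
    (hb : E.RightNormalBasis x) : E.IsCleft x := by
  obtain ⟨m, hm, hb⟩ := hb.exists_isColinear
  exact E.isCleft_of_isColinear hm ((starCan_bijective_iff hm hb).1 h)

/-- The map `A ⊗ C → A ⊗_{B'} A`, `a ⊗ c ↦ a ⊗ m(c)`. -/
def balOfTensor (E : Entwining k A C) (x : C) (m : C →ₗ[k] A) :
    A ⊗[k] C →ₗ[k] BalTensor k (B := E.coinvRing x) A A :=
  TensorProduct.lift ((balMk k (B := E.coinvRing x) A A).compl₂ m)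

@[simp] lemma balOfTensor_tmul (a : A) (c : C) :
    balOfTensor E x m (a ⊗ₜ c) = balTmul k (B := E.coinvRing x) a (m c) := rfl

/-- This is `A ⊗ C ≅ A ⊗_{B'} (B' ⊗ C) ≅ A ⊗_{B'} A`; the inverse `G` expands the second factor in
the basis and absorbs the coefficient from `B'` into the first. -/
lemma balOfTensor_bijective (h : Function.Bijective (mulMap (E := E) (x := x) m)) :
    Function.Bijective (balOfTensor E x m) := by
  let e := LinearEquiv.ofBijective (mulMap (E := E) (x := x) m) h
  let F : A →ₗ[k] E.coinvRing x ⊗[k] C →ₗ[k] A ⊗[k] C :=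
    (LinearMap.rTensorHom C).comp ((LinearMap.mul k A).compl₂ (E.coinvRing x).val.toLinearMap)
  have hF : ∀ a b c, F a (b ⊗ₜ c) = (a * (b : A)) ⊗ₜ c := fun a b c => rfl
  have hF' : ∀ (a : A) (b : E.coinvRing x) t, F (a * (b : A)) t = F a (b • t) := fun a b t => by
    induction t using TensorProduct.induction_on with
    | zero => simp
    | add t₁ t₂ h₁ h₂ => simp only [map_add, smul_add, h₁, h₂]
    | tmul b' c => simp [hF, TensorProduct.smul_tmul', mul_assoc]
  let G : BalTensor k (B := E.coinvRing x) A A →ₗ[k] A ⊗[k] C :=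
    balLift (F.compl₂ (e.symm.toLinearMap.restrictScalars k)) (fun a b a' => by
      change F (a * (b : A)) (e.symm a') = F a (e.symm (b • a'))
      rw [hF', ← e.symm.map_smul])
  have hG : ∀ a a', G (balTmul k a a') = F a (e.symm a') := fun a a' => balLift_tmul _ _ a a'
  refine Function.bijective_iff_has_inverse.2 ⟨G,
    fun t => LinearMap.congr_fun (f := G ∘ₗ balOfTensor E x m) (g := LinearMap.id)
      (TensorProduct.ext' fun a c => ?_) t,
    fun t => LinearMap.congr_fun (f := balOfTensor E x m ∘ₗ G) (g := LinearMap.id)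
      (BalTensor.ext_hom fun a a' => ?_) t⟩
  · have : e.symm (m c) = 1 ⊗ₜ c := e.injective (by
      rw [e.apply_symm_apply]
      change m c = mulMap m (1 ⊗ₜ[k] c)
      simp)
    simp [hG, this, hF]
  · obtain ⟨t, rfl⟩ := e.surjective a'
    rw [LinearMap.comp_apply, hG, e.symm_apply_apply, LinearMap.id_apply]
    induction t using TensorProduct.induction_on with
    | zero => simp only [map_zero]; exact (map_zero (balMk k (B := E.coinvRing x) A A a)).symm
    | add t₁ t₂ h₁ h₂ =>
      simp only [map_add, h₁, h₂]
      exact (map_add (balMk k (B := E.coinvRing x) A A a) _ _).symm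
    | tmul b c => exact balTmul_smul a b (m c)

/-- In basis coordinates `can` is `a ⊗ c ↦ a m(c₁) ⊗ c₂`. Since `rightEval A` identifies `Hom_k(C,
A)` with the left `A`-linear maps `A ⊗ C → A`, precomposing with it amounts to `f ↦ m * f`. -/
lemma rightEval_can_balOfTensor (hm : E.IsColinear x m) (f : C →ₗ[k] A) (t : A ⊗[k] C) :
    rightEval A f (E.can x (balOfTensor E x m t)) =
      rightEval A (toConv m * toConv f).ofConv t := by
  induction t using TensorProduct.induction_on with
  | zero => simp
  | add t₁ t₂ h₁ h₂ => simp only [map_add, h₁, h₂]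
  | tmul a c =>
    rw [balOfTensor_tmul, can_tmul, hm, rightEval_smul]
    have e : ∀ s : C ⊗[k] C, rightEval A f (m.rTensor C s) =
        LinearMap.mul' k A (TensorProduct.map m f s) := fun s => by
      induction s using TensorProduct.induction_on with
      | zero => simp
      | add t₁ t₂ h₁ h₂ => simp only [map_add, h₁, h₂]
      | tmul c d => simp
    rw [e]
    rfl

lemma can_balOfTensor_smul (a : A) (t : A ⊗[k] C) :
    E.can x (balOfTensor E x m (a • t)) = a • E.can x (balOfTensor E x m t) := by
  induction t using TensorProduct.induction_on with
  | zero => simp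
  | add t₁ t₂ h₁ h₂ => simp only [map_add, smul_add, h₁, h₂]
  | tmul b c =>
    rw [TensorProduct.smul_tmul', balOfTensor_tmul, balOfTensor_tmul, can_tmul, can_tmul,
      smul_eq_mul, mul_smul]

/-- The map `θ`, which is `can` in basis coordinates, is a left `A`-linear automorphism of `A ⊗ C`.
Its `A`-dual `f ↦ m * f` is then bijective as well. -/
theorem IsGalois.isCleft (h : E.IsGalois x) (hb : E.RightNormalBasis x) : E.IsCleft x := by
  obtain ⟨m, hm, hb⟩ := hb.exists_isColinear
  let θ := LinearEquiv.ofBijective (E.can x ∘ₗ balOfTensor E x m)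
    (h.comp (balOfTensor_bijective hb))
  have hθ : ∀ (f : C →ₗ[k] A) t, rightEval A f (θ t) =
    rightEval A (toConv m * toConv f).ofConv t := rightEval_can_balOfTensor hm
  have hθs : ∀ (a : A) t, θ.symm (a • t) = a • θ.symm t := fun a t => θ.injective (by
    rw [θ.apply_symm_apply]
    refine Eq.trans ?_ (can_balOfTensor_smul a (θ.symm t)).symm
    change a • t = a • θ (θ.symm t)
    rw [θ.apply_symm_apply])
  have h1 : ∀ (f : C →ₗ[k] A) c, rightEval A f (1 ⊗ₜ c) = f c := fun f c => by simp
  refine E.isCleft_of_isColinear hm ⟨fun f g hfg => ?_, fun g => ?_⟩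
  · ext c
    have hfg : toConv m * toConv f = toConv m * toConv g := hfg
    rw [← h1, ← h1 g, ← θ.apply_symm_apply (1 ⊗ₜ c), hθ, hθ, hfg]
  · let f : C →ₗ[k] A :=
      rightEval A g.ofConv ∘ₗ θ.symm.toLinearMap ∘ₗ TensorProduct.mk k A C 1
    have hf : ∀ t, rightEval A f t = rightEval A g.ofConv (θ.symm t) := fun t => by
      induction t using TensorProduct.induction_on with
      | zero => simp
      | add t₁ t₂ h₁ h₂ => simp only [map_add, h₁, h₂]
      | tmul a c =>
        have e : a ⊗ₜ[k] c = a • ((1 : A) ⊗ₜ[k] c) := by simp [TensorProduct.smul_tmul']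
        rw [e, hθs, rightEval_smul, rightEval_smul, h1]
        rfl
    refine ⟨f, ofConv_injective (LinearMap.ext fun c => ?_)⟩
    change (toConv m * toConv f).ofConv c = g.ofConv c
    rw [← h1, ← hθ, hf, θ.symm_apply_apply, h1]

end NormalBasis

end Entwining

end

/-! ### The equivalence of the four assertions. -/

theorem mainTheorem1 (k : Type uk) (A : Type uA) (C : Type uC) [CommRing k] [Ring A]
    [Algebra k A] [AddCommGroup C] [Module k C] [Coalgebra k C] (E : Entwining k A C) (x : C)
    (hx : IsGroupLikeElem k x) :
    List.TFAE [
      E.IsCleft x,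
      Entwining.StrongStructure.{uk, uA, uC, w} E hx ∧ E.RightNormalBasis x,
      E.IsGalois x ∧ E.RightNormalBasis x,
      Function.Bijective (E.starCan x) ∧ E.RightNormalBasis x] := by
  tfae_have 1 → 2 := fun h => ⟨Entwining.IsCleft.strongStructure E hx h,
    Entwining.IsCleft.rightNormalBasis E hx h⟩
  tfae_have 2 → 3 := fun h => ⟨Entwining.WeakStructure.isGalois E hx h.1.1, h.2⟩
  tfae_have 3 → 1 := fun h => Entwining.IsGalois.isCleft h.1 h.2
  tfae_have 1 → 4 := fun h => ⟨Entwining.IsCleft.starCan_bijective hx h,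
    Entwining.IsCleft.rightNormalBasis E hx h⟩
  tfae_have 4 → 1 := fun h => Entwining.isCleft_of_starCan_bijective h.1 h.2
  tfae_finish
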